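/- Let $G=\mathrm{PSL}(2,\mathbb R)$, and write its elements in Iwasawa coordinates as $g=n[x]a[y]k[\theta]$ with $n[x]=\begin{pmatrix}1&x\\0&1\end{pmatrix}$, $a[y]=\begin{pmatrix}\sqrt y&0\\0&1/\sqrt y\end{pmatrix}$, $k[\theta]=\begin{pmatrix}\cos\theta&\sin\theta\\-\sin\theta&\cos\theta\end{pmatrix}$, where $x\in\mathbb R$, $y>0$, $\theta\in\mathbb R/\pi\mathbb Z$; let $w=\begin{pmatrix}0&1\\-1&0\end{pmatrix}$ and $e(t)=\exp(2\pi it)$. For $p\in\mathbb Z$, $\nu\in\mathbb C$ put $\phi_p(g,\nu)=y^{\nu+1/2}e^{2pi\theta}$. Let $U_\nu=\bigoplus_{p\in\mathbb Z}\mathbb C\phi_p(\cdot,\nu)$ be the Hilbert space of all $\phi=\sum_pc_p\phi_p$ with $\|\phi\|^2=\sum_p|c_p|^2<\infty$; its elements are the functions $n[x]a[y]k[\theta]\mapsto y^{\nu+1/2}\sum_pc_pe^{2pi\theta}$, the series being taken in $L^2(\mathbb R/\pi\mathbb Z)$. Call $\phi$ smooth if $c_p$ decays faster than any negative power of $|p|$.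 For $\delta=\pm1$ and smooth $\phi(\cdot,\nu)=\sum_pc_p\phi_p(\cdot,\nu)$ let Jacquet's integral be $$\mathcal A^\delta\phi(g,\nu)=\int_{-\infty}^\infty e(-\delta\xi)\,\phi(w\,n[\xi]\,g,\nu)\,d\xi ,$$ which converges absolutely for $\operatorname{Re}\nu>0$ and is defined for $\operatorname{Re}\nu>-\tfrac12$ by analytic continuation in $\nu$ (with the $c_p$ fixed). The Kirillov operator is given on smooth $\phi\in U_\nu$ by $$K\phi(u)=\mathcal A^{\operatorname{sgn}u}\phi(a[|u|],\nu),\qquad u\in\mathbb R^\times=\mathbb R\setminus\{0\}.$$ **Lemma 6.2.** Let $\nu\in i\mathbb R$. For every smooth $\phi\in U_\nu$ the value $K\phi(u)$ is defined (that is, the stated absolute convergence and analytic continuation hold at $g=a[|u|]$, $\delta=\operatorname{sgn}u$) for every $u\ne0$, and $K$ extends uniquely from the smooth vectors to a bounded linear operator from $U_\nu$ to $L^2(\mathbb R^\times,\pi^{-1}d^\times)$, where $d^\times u=du/|u|$. This operator $K$ is a unitary map of $U_\nu$ onto $L^2(\mathbb R^\times,\pi^{-1}d^\times)$. In particular, right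 translation $\omega(h):f(g)\mapsto f(gh)$ acts on $U_\nu$, and $\omega$ and $K\omega K^{-1}$ are (strongly continuous) unitary representations of $G$ in $U_\nu$ and in $L^2(\mathbb R^\times,\pi^{-1}d^\times)$, respectively, which are unitarily equivalent. -/

import Mathlib

open MeasureTheory
open scoped ENNReal

noncomputable section

namespace Kirillov

/-! ## The group `PSL(2, ℝ)` and its Iwasawa coordinates -/

/-- The group `G = PSL(2, ℝ)`, with the quotient topology. -/
abbrev G : Type := Matrix.ProjectiveSpecialLinearGroup (Fin 2) ℝ

/-- The class in `G` of a matrix of determinant one. -/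
def mk (g : Matrix.SpecialLinearGroup (Fin 2) ℝ) : G := QuotientGroup.mk g

/-- `n[x] = [1, x; 0, 1]`. -/
def n (x : ℝ) : G := mk ⟨!![1, x; 0, 1], by simp [Matrix.det_fin_two]⟩

/-- `a[y] = [√y, 0; 0, 1/√y]` for `y > 0` (and the neutral element for `y ≤ 0`, never used). -/
def a (y : ℝ) : G :=
  if hy : 0 < y then
    mk ⟨!![√y, 0; 0, 1 / √y], by
      have h : √y ≠ 0 := (Real.sqrt_pos.2 hy).ne'
      simp [Matrix.det_fin_two, h]⟩
  else 1

/-- `k[θ] = [cos θ, sin θ; -sin θ, cos θ]`. -/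
def k (θ : ℝ) : G :=
  mk ⟨!![Real.cos θ, Real.sin θ; -Real.sin θ, Real.cos θ], by
    simp [Matrix.det_fin_two, ← sq]⟩

/-- The Weyl element `w = [0, 1; -1, 0]`. -/
def w : G := mk ⟨!![0, 1; -1, 0], by simp [Matrix.det_fin_two]⟩

instance factPiPos : Fact (0 < Real.pi) := ⟨Real.pi_pos⟩

/-- The bottom row `(c, d)` of a matrix, as the complex number `d - i c`. -/
def bottom (g : Matrix.SpecialLinearGroup (Fin 2) ℝ) : ℂ :=
  (g.1 1 1 : ℂ) - Complex.I * (g.1 1 0 : ℂ)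

theorem bottom_ne_zero (g : Matrix.SpecialLinearGroup (Fin 2) ℝ) : bottom g ≠ 0 := by
  intro h
  have h1 : g.1 1 1 = 0 := by simpa [bottom] using congrArg Complex.re h
  have h2 : g.1 1 0 = 0 := by simpa [bottom] using congrArg Complex.im h
  have h3 := g.2
  rw [Matrix.det_fin_two, h1, h2] at h3
  simp at h3

theorem bottom_eq_or_neg {g h : Matrix.SpecialLinearGroup (Fin 2) ℝ}
    (hgh : (QuotientGroup.leftRel
      (Subgroup.center (Matrix.SpecialLinearGroup (Fin 2) ℝ))) g h) :
    bottom h = bottom g ∨ bottom h = -bottom g := by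
  rw [QuotientGroup.leftRel_apply, Matrix.SpecialLinearGroup.mem_center_iff] at hgh
  obtain ⟨r, hr, hA⟩ := hgh
  have hmul : h.1 = g.1 * Matrix.scalar (Fin 2) r := by
    rw [hA, ← Matrix.SpecialLinearGroup.coe_mul]
    simp
  have hr' : r = 1 ∨ r = -1 := by
    have : r ^ 2 = 1 := by simpa using hr
    have h0 : (r - 1) * (r + 1) = 0 := by linear_combination this
    rcases mul_eq_zero.mp h0 with h1 | h1
    · left; linarith
    · right; linarith
  rcases hr' with rfl | rfl
  · left
    simp [bottom, hmul]
  · right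
    simp [bottom, hmul, Matrix.mul_apply, Fin.sum_univ_two]
    ring

/-- The coordinate `y = (c² + d²)⁻¹` of `g = n[x] a[y] k[θ]`. -/
def height : G → ℝ :=
  Quotient.lift (fun g => (Complex.normSq (bottom g))⁻¹) (by
    intro g h hgh
    rcases bottom_eq_or_neg hgh with e | e <;> simp [e])

/-- The coordinate `θ ∈ ℝ/πℤ` of `g = n[x] a[y] k[θ]`, given by
`exp(iθ) = (d - ic)/|d - ic|`. -/
def angle : G → AddCircle Real.pi :=
  Quotient.lift (fun g => ((Complex.arg (bottom g) : ℝ) : AddCircle Real.pi)) (by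
    intro g h hgh
    rcases bottom_eq_or_neg hgh with e | e
    · simp [e]
    · have h0 := Complex.arg_neg_coe_angle (bottom_ne_zero g)
      rw [← Real.Angle.coe_add, Real.Angle.angle_eq_iff_two_pi_dvd_sub] at h0
      obtain ⟨m, hm⟩ := h0
      simp only [e]
      rw [eq_comm, ← sub_eq_zero, ← AddCircle.coe_sub, AddCircle.coe_eq_zero_iff]
      exact ⟨2 * m + 1, by push_cast [zsmul_eq_mul]; linarith⟩)

/-! ## The functions `φ_p` and the Hilbert space `U_ν` -/

/-- `φ_p(g, ν) = y^(ν + 1/2) exp(2piθ)` for `g = n[x] a[y] k[θ]`. -/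
def phi (p : ℤ) (ν : ℂ) (g : G) : ℂ :=
  ((height g : ℝ) : ℂ) ^ (ν + 1 / 2) * fourier p (angle g)

/-- The Hilbert space `U_ν = ⨁_p ℂ φ_p` with `‖∑ c_p φ_p‖² = ∑ |c_p|²`. The vector
`∑ c_p φ_p` is given by its square-summable sequence of coefficients `c_p`;
`toFun` turns it into a function on `G`. -/
abbrev U : Type := lp (fun _ : ℤ => ℂ) 2

/-- The vector `∑ c_p φ_p(·, ν)` of `U_ν` as a function on `G`:
`n[x] a[y] k[θ] ↦ y^(ν + 1/2) F(θ)` with `F = ∑ c_p exp(2piθ)` in `L²(ℝ/πℤ)`. As any element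
of an `L²` space, it is a definite function only up to a null set of `θ`. -/
def toFun (ν : ℂ) (c : U) (g : G) : ℂ :=
  ((height g : ℝ) : ℂ) ^ (ν + 1 / 2) *
    ((fourierBasis (T := Real.pi)).repr.symm c : Lp ℂ 2 AddCircle.haarAddCircle) (angle g)

/-- `c'` is the right translate of `c` by `h`: the functions `g ↦ φ(g h)`, for `φ = ∑ c_p φ_p`,
and `∑ c'_p φ_p` agree as elements of `U_ν`. -/
def IsRightTranslate (ν : ℂ) (h : G) (c c' : U) : Prop :=
  ∀ x y : ℝ, 0 < y → ∀ᵐ θ : ℝ,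
    toFun ν c' (n x * a y * k θ) = toFun ν c (n x * a y * k θ * h)

/-- Smooth vectors of `U_ν`: the coefficients decay faster than any power of `|p|`. -/
def IsSmooth (c : U) : Prop :=
  ∀ N : ℕ, ∃ C : ℝ, ∀ p : ℤ, |(p : ℝ)| ^ N * ‖c p‖ ≤ C

/-- The function `φ(g, s) = ∑ c_p φ_p(g, s)` for smooth `c`; the series converges absolutely. -/
def smoothFun (c : U) (s : ℂ) (g : G) : ℂ := ∑' p : ℤ, c p * phi p s g

/-! ## Jacquet's integral and the Kirillov operator -/

/-- `e(x) = exp(2πix)`. -/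
def e (x : ℝ) : ℂ := Complex.exp (2 * Real.pi * Complex.I * x)

/-- Jacquet's integral `∫ e(-δξ) f(w n[ξ] g) dξ`, used only where it converges absolutely. -/
def jacquetIntegral (δ : ℝ) (f : G → ℂ) (g : G) : ℂ :=
  ∫ ξ : ℝ, e (-(δ * ξ)) * f (w * n ξ * g)

/-- With `φ(·, s) = ∑ c_p φ_p(·, s)`, Jacquet's integral `A^δ φ(g, s)` converges absolutely for
`Re s > 0`, and `F` continues it analytically, as a function of `s`, to `Re s > -1/2`. -/
def IsJacquetContinuation (δ : ℝ) (c : U) (g : G) (F : ℂ → ℂ) : Prop :=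
  DifferentiableOn ℂ F {s | -(1 / 2 : ℝ) < s.re} ∧
    ∀ s : ℂ, 0 < s.re →
      Integrable (fun ξ : ℝ => e (-(δ * ξ)) * smoothFun c s (w * n ξ * g)) ∧
        F s = jacquetIntegral δ (smoothFun c s) g

open Classical in
/-- `A^δ φ(g, ν)` for a smooth vector `φ = ∑ c_p φ_p(·, ν)` and `Re ν > -1/2`, by analytic
continuation in `ν` of Jacquet's integral. (Two continuations agree on `Re ν > -1/2`.) -/
def jacquet (δ : ℝ) (c : U) (ν : ℂ) (g : G) : ℂ :=
  if h : ∃ F : ℂ → ℂ, IsJacquetContinuation δ c g F then h.choose ν else 0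

/-- `K φ(u) = A^{sgn u} φ(a[|u|])` for a smooth vector `φ = ∑ c_p φ_p(·, ν)` and `u ≠ 0`. -/
def kirillov (ν : ℂ) (c : U) (u : ℝ) : ℂ := jacquet (Real.sign u) c ν (a |u|)

/-- The measure `π⁻¹ d^×u = du / (π |u|)` on `ℝ^× = ℝ ∖ {0}`, extended by zero to `ℝ`. -/
def mulMeasure : Measure ℝ :=
  (volume.restrict ({0}ᶜ : Set ℝ)).withDensity fun u => ENNReal.ofReal (1 / (Real.pi * |u|))

/-- The Hilbert space `L²(ℝ^×, π⁻¹ d^×)`. -/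
abbrev L2 : Type := Lp ℂ 2 mulMeasure

/-- `T` is a bounded operator from `U_ν` to `L²(ℝ^×, π⁻¹ d^×)` which on smooth vectors is given
by `φ ↦ K φ`. -/
def ExtendsKirillov (ν : ℂ) (T : U →L[ℂ] L2) : Prop :=
  ∀ c : U, IsSmooth c → (T c : ℝ → ℂ) =ᵐ[mulMeasure] kirillov ν c

/-! ## Unitary representations of `G` -/

/-- A homomorphism of `G` to the unitary operators of `H` is a unitary representation if it is
strongly continuous. -/
def IsUnitaryRep {H : Type*} [NormedAddCommGroup H] [InnerProductSpace ℂ H]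
    (ρ : G →* (H ≃ₗᵢ[ℂ] H)) : Prop :=
  ∀ v : H, Continuous fun g : G => ρ g v

/-- Unitary equivalence of two representations. -/
def UnitarilyEquivalent {H₁ H₂ : Type*} [NormedAddCommGroup H₁] [InnerProductSpace ℂ H₁]
    [NormedAddCommGroup H₂] [InnerProductSpace ℂ H₂]
    (ρ₁ : G →* (H₁ ≃ₗᵢ[ℂ] H₁)) (ρ₂ : G →* (H₂ ≃ₗᵢ[ℂ] H₂)) : Prop :=
  ∃ S : H₁ ≃ₗᵢ[ℂ] H₂, ∀ (g : G) (v : H₁), S (ρ₁ g v) = ρ₂ g (S v)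

end Kirillov

end

/-!
On the big cell `t ↦ w n[t]` the coordinates are `y = (1 + t²)⁻¹` and `θ = π/2 + arctan t`, so
restricting `φ = ∑ c_p φ_p(·, s)` to it gives the function
`f_s(t) = (1 + t²)^{-(s + 1/2)} F(θ(t))` on the line, where `F = ∑ c_p exp(2piθ)` (`bigCell`).
Rescaling the variable, Jacquet's integral at `a[|u|]` becomes `|u|^{1/2 - s}` times the Fourier
integral of `f_s` at `u` (`jacquetIntegral_eq_fourier`). It converges absolutely for `Re s > 0`.
For smooth `φ` the derivative `f_s'` has one more power of decay, so one integration by parts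
continues the Fourier integral to `Re s > -1/2` (`isJacquetContinuation`).

For `Re ν = 0`, since `dθ = dt / (1 + t²)`, the map `F ↦ π^{-1/2} f_ν` is unitary from the
normalized `L²(ℝ/πℤ)` to `L²(ℝ)`. The Plancherel transform is unitary, and so is multiplication by
`π^{1/2} |u|^{1/2 - ν}` from `L²(ℝ, du)` to `L²(ℝ^×, π⁻¹ d^×u)`. Their composite is
`kirillovEquiv`. On smooth vectors it is the Kirillov operator (`kirillovEquiv_extends`): along
`s = ν + 1/(m + 1)` the functions `f_s` tend to `f_ν` in `L²`, so a subsequence of their Fourier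
transforms converges almost everywhere to the Plancherel transform of `f_ν`, while the values of
any continuation converge pointwise. Finitely supported sequences are smooth and dense, which gives
uniqueness.

Right translation by `h` acts on the circle by `θ ↦ θ(k[θ] h)` with the factor
`y(k[θ] h)^{ν + 1/2}`. The Jacobian of this map is `y(k[θ] h)`; in the coordinate `t` this is
the change of variables for a Möbius transformation (`lintegral_angle_rot_mul`). Hence the
translation is unitary. It is strongly continuous because translates of a continuous function on
the compact circle depend continuously, in the supremum norm, on `h`.
-/

noncomputable section

namespace Kirillov

/-! ### Iwasawa coordinates of products -/

theorem height_mk (g : Matrix.SpecialLinearGroup (Fin 2) ℝ) :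
    height (mk g) = (Complex.normSq (bottom g))⁻¹ := rfl

theorem angle_mk (g : Matrix.SpecialLinearGroup (Fin 2) ℝ) :
    angle (mk g) = ((Complex.arg (bottom g) : ℝ) : AddCircle Real.pi) := rfl

theorem mk_mul (g h : Matrix.SpecialLinearGroup (Fin 2) ℝ) : mk (g * h) = mk g * mk h := rfl

theorem mk_surjective : Function.Surjective mk := QuotientGroup.mk_surjective

theorem height_pos (g : G) : 0 < height g := by
  obtain ⟨g, rfl⟩ := mk_surjective g
  rw [height_mk]
  exact inv_pos.2 (Complex.normSq_pos.2 (bottom_ne_zero g))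

/-- The angle in terms of the bottom row: `exp(2iθ) = b / conj b` for `b = d - ic`. -/
theorem toCircle_angle_mk (g : Matrix.SpecialLinearGroup (Fin 2) ℝ) :
    ((AddCircle.toCircle (angle (mk g)) : Circle) : ℂ)
      = bottom g / (starRingEnd ℂ) (bottom g) := by
  rw [angle_mk, AddCircle.toCircle_apply_mk, Circle.coe_exp]
  have hb := bottom_ne_zero g
  have h1 := Complex.norm_mul_exp_arg_mul_I (bottom g)
  have hn : (‖bottom g‖ : ℂ) ≠ 0 := by exact_mod_cast (norm_pos_iff.2 hb).ne'
  have h2 : (starRingEnd ℂ) (bottom g) ≠ 0 := by simpa using hb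
  have h3 : bottom g * (starRingEnd ℂ) (bottom g) = (‖bottom g‖ : ℂ) ^ 2 := Complex.mul_conj' _
  rw [eq_div_iff h2]
  have h4 : Complex.exp (((2 * Real.pi / Real.pi * Complex.arg (bottom g) : ℝ) : ℂ) * Complex.I)
      = Complex.exp (Complex.arg (bottom g) * Complex.I) ^ 2 := by
    rw [← Complex.exp_nat_mul]
    congr 1
    rw [mul_div_assoc, div_self Real.pi_ne_zero]
    push_cast
    ring
  rw [h4]
  apply mul_left_cancel₀ hb
  set E := Complex.exp (Complex.arg (bottom g) * Complex.I)
  linear_combination E ^ 2 * h3 + (‖bottom g‖ * E + bottom g) * h1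

/-- Proportional bottom rows stay proportional under right multiplication. -/
theorem bottom_mul_of_bottom_eq {g g' : Matrix.SpecialLinearGroup (Fin 2) ℝ} {r : ℝ}
    (hb : bottom g' = r * bottom g) (h : Matrix.SpecialLinearGroup (Fin 2) ℝ) :
    bottom (g' * h) = r * bottom (g * h) := by
  have h1 : g'.1 1 1 = r * g.1 1 1 := by simpa [bottom] using congrArg Complex.re hb
  have h2 : g'.1 1 0 = r * g.1 1 0 := by simpa [bottom] using congrArg Complex.im hb
  simp only [bottom, Matrix.SpecialLinearGroup.coe_mul, Matrix.mul_apply, Fin.sum_univ_two, h1, h2]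
  push_cast
  ring

theorem height_of_bottom_eq {g g' : Matrix.SpecialLinearGroup (Fin 2) ℝ} {r : ℝ}
    (hb : bottom g' = r * bottom g) : height (mk g') = (r ^ 2)⁻¹ * height (mk g) := by
  rw [height_mk, height_mk, hb, map_mul, Complex.normSq_ofReal, mul_inv, sq]

theorem angle_of_bottom_eq {g g' : Matrix.SpecialLinearGroup (Fin 2) ℝ} {r : ℝ}
    (hb : bottom g' = r * bottom g) : angle (mk g') = angle (mk g) := by
  apply AddCircle.injective_toCircle Real.pi_ne_zero
  ext
  have hr : (r : ℂ) ≠ 0 := by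
    intro h
    rw [h, zero_mul] at hb
    exact bottom_ne_zero g' hb
  rw [toCircle_angle_mk, toCircle_angle_mk, hb, map_mul, Complex.conj_ofReal,
    mul_div_mul_left _ _ hr]

/-- The matrix representing `k[θ]`. -/
def rotMatrix (θ : ℝ) : Matrix.SpecialLinearGroup (Fin 2) ℝ :=
  ⟨!![Real.cos θ, Real.sin θ; -Real.sin θ, Real.cos θ], by
    simp [Matrix.det_fin_two, ← sq]⟩

theorem k_eq (θ : ℝ) : k θ = mk (rotMatrix θ) := rfl

theorem bottom_rotMatrix (θ : ℝ) : bottom (rotMatrix θ) = Complex.exp (θ * Complex.I) := by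
  rw [Complex.exp_mul_I]
  simp [bottom, rotMatrix]
  ring

theorem k_periodic : Function.Periodic k Real.pi := by
  intro θ
  rw [k_eq, k_eq]
  refine (QuotientGroup.eq).2 ?_
  have : rotMatrix (θ + Real.pi) = rotMatrix θ * (-1) := by
    rw [mul_neg_one]
    ext i j
    rw [Matrix.SpecialLinearGroup.coe_neg]
    fin_cases i <;> fin_cases j <;> simp [rotMatrix]
  rw [this, mul_inv_rev, mul_assoc, inv_mul_cancel, mul_one, inv_mem_iff]
  rw [Subgroup.mem_center_iff]
  intro g
  simp

/-- The compact subgroup, parametrized by the circle: `rot θ = k[θ]` for `θ ∈ ℝ/πℤ`. -/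
def rot : AddCircle Real.pi → G := k_periodic.lift

theorem rot_coe (θ : ℝ) : rot (θ : AddCircle Real.pi) = k θ := k_periodic.lift_coe θ

theorem height_k (θ : ℝ) : height (k θ) = 1 := by
  rw [k_eq, height_mk, bottom_rotMatrix, Complex.normSq_eq_norm_sq, Complex.norm_exp_ofReal_mul_I]
  simp

theorem angle_k (θ : ℝ) : angle (k θ) = (θ : AddCircle Real.pi) := by
  apply AddCircle.injective_toCircle Real.pi_ne_zero
  ext
  rw [k_eq, toCircle_angle_mk, bottom_rotMatrix, ← Complex.exp_conj, ← Complex.exp_sub,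
    AddCircle.toCircle_apply_mk, Circle.coe_exp, mul_div_assoc, div_self Real.pi_ne_zero]
  congr 1
  simp
  ring

theorem height_rot (z : AddCircle Real.pi) : height (rot z) = 1 := by
  induction z using QuotientAddGroup.induction_on with
  | H θ => exact (congrArg height (rot_coe θ)).trans (height_k θ)

theorem angle_rot (z : AddCircle Real.pi) : angle (rot z) = z := by
  induction z using QuotientAddGroup.induction_on with
  | H θ => exact (congrArg angle (rot_coe θ)).trans (angle_k θ)

theorem bottom_eq_norm_mul_rotMatrix (g : Matrix.SpecialLinearGroup (Fin 2) ℝ) :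
    bottom g = (‖bottom g‖ : ℝ) * bottom (rotMatrix (Complex.arg (bottom g))) := by
  rw [bottom_rotMatrix, Complex.norm_mul_exp_arg_mul_I]

/-- The height of a product depends on the left factor only through its `y` and `θ`. -/
theorem height_mul (g h : G) : height (g * h) = height g * height (rot (angle g) * h) := by
  obtain ⟨g, rfl⟩ := mk_surjective g
  obtain ⟨h, rfl⟩ := mk_surjective h
  rw [angle_mk, rot_coe, k_eq, ← mk_mul, ← mk_mul,
    height_of_bottom_eq (bottom_mul_of_bottom_eq (bottom_eq_norm_mul_rotMatrix g) h),
    height_mk g, Complex.normSq_eq_norm_sq]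

/-- The angle of a product depends on the left factor only through its `θ`. -/
theorem angle_mul (g h : G) : angle (g * h) = angle (rot (angle g) * h) := by
  obtain ⟨g, rfl⟩ := mk_surjective g
  obtain ⟨h, rfl⟩ := mk_surjective h
  rw [angle_mk, rot_coe, k_eq, ← mk_mul, ← mk_mul,
    angle_of_bottom_eq (bottom_mul_of_bottom_eq (bottom_eq_norm_mul_rotMatrix g) h)]

/-- The matrix representing `n[x]`. -/
def shearMatrix (x : ℝ) : Matrix.SpecialLinearGroup (Fin 2) ℝ :=
  ⟨!![1, x; 0, 1], by simp [Matrix.det_fin_two]⟩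

/-- The matrix representing `a[y]` for `y > 0`. -/
def diagMatrix {y : ℝ} (hy : 0 < y) : Matrix.SpecialLinearGroup (Fin 2) ℝ :=
  ⟨!![√y, 0; 0, 1 / √y], by
    have h : √y ≠ 0 := (Real.sqrt_pos.2 hy).ne'
    simp [Matrix.det_fin_two, h]⟩

/-- The matrix representing `w`. -/
def weylMatrix : Matrix.SpecialLinearGroup (Fin 2) ℝ :=
  ⟨!![0, 1; -1, 0], by simp [Matrix.det_fin_two]⟩

theorem coe_shearMatrix (x : ℝ) : (shearMatrix x).1 = !![1, x; 0, 1] := rfl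

theorem coe_diagMatrix {y : ℝ} (hy : 0 < y) : (diagMatrix hy).1 = !![√y, 0; 0, 1 / √y] := rfl

theorem coe_weylMatrix : weylMatrix.1 = !![0, 1; -1, 0] := rfl

theorem n_eq (x : ℝ) : n x = mk (shearMatrix x) := rfl

theorem a_eq {y : ℝ} (hy : 0 < y) : a y = mk (diagMatrix hy) := dif_pos hy

theorem bottom_n_a_mul (x : ℝ) {y : ℝ} (hy : 0 < y) (g : Matrix.SpecialLinearGroup (Fin 2) ℝ) :
    bottom (shearMatrix x * diagMatrix hy * g) = ((1 / √y : ℝ) : ℂ) * bottom g := by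
  simp [coe_shearMatrix, coe_diagMatrix, bottom, Matrix.SpecialLinearGroup.coe_mul,
    Matrix.mul_apply, Fin.sum_univ_two]
  ring

theorem height_n_a_mul (x : ℝ) {y : ℝ} (hy : 0 < y) (g : G) :
    height (n x * a y * g) = y * height g := by
  obtain ⟨g, rfl⟩ := mk_surjective g
  rw [n_eq, a_eq hy, ← mk_mul, ← mk_mul, height_of_bottom_eq (bottom_n_a_mul x hy g), div_pow,
    Real.sq_sqrt hy.le]
  simp

theorem angle_n_a_mul (x : ℝ) {y : ℝ} (hy : 0 < y) (g : G) :
    angle (n x * a y * g) = angle g := by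
  obtain ⟨g, rfl⟩ := mk_surjective g
  rw [n_eq, a_eq hy, ← mk_mul, ← mk_mul, angle_of_bottom_eq (bottom_n_a_mul x hy g)]

/-! ### Continuity of the coordinates -/

theorem continuous_bottom : Continuous bottom := by
  have h : Continuous fun g : Matrix.SpecialLinearGroup (Fin 2) ℝ => g.1 := continuous_subtype_val
  unfold bottom
  have h1 := h.matrix_elem 1 1
  have h2 := h.matrix_elem 1 0
  fun_prop

theorem continuous_height : Continuous height := by
  refine continuous_quot_lift _ ?_
  exact (Complex.continuous_normSq.comp continuous_bottom).inv₀
    fun g => (Complex.normSq_pos.2 (bottom_ne_zero g)).ne'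

theorem continuous_angle : Continuous angle := by
  have h1 : Continuous fun g : G => AddCircle.toCircle (angle g) := by
    rw [QuotientGroup.isOpenQuotientMap_mk.isQuotientMap.continuous_iff]
    refine continuous_induced_rng.2 ?_
    have : (Subtype.val : Circle → ℂ) ∘ ((fun g : G => AddCircle.toCircle (angle g)) ∘
        (QuotientGroup.mk : Matrix.SpecialLinearGroup (Fin 2) ℝ → G))
        = fun g => bottom g / (starRingEnd ℂ) (bottom g) :=
      funext fun g => toCircle_angle_mk g
    change Continuous ((Subtype.val : Circle → ℂ) ∘ ((fun g : G => AddCircle.toCircle (angle g)) ∘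
        (QuotientGroup.mk : Matrix.SpecialLinearGroup (Fin 2) ℝ → G)))
    rw [this]
    exact continuous_bottom.div (Complex.continuous_conj.comp continuous_bottom)
      fun g => by simpa using bottom_ne_zero g
  have h2 := (AddCircle.homeomorphCircle (T := Real.pi) Real.pi_ne_zero).symm.continuous.comp h1
  convert h2 using 1
  funext g
  simp only [Function.comp]
  rw [← AddCircle.homeomorphCircle_apply Real.pi_ne_zero, Homeomorph.symm_apply_apply]

theorem continuous_rot : Continuous rot := by
  have hk : Continuous k := by
    have : Continuous rotMatrix := by
      refine Continuous.subtype_mk ?_ _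
      refine continuous_matrix fun i j => ?_
      fin_cases i <;> fin_cases j <;> simp <;> fun_prop
    exact QuotientGroup.continuous_mk.comp this
  refine continuous_quot_lift _ hk

/-! ### Weighted composition operators between `L²` spaces -/

section WeightedComposition

variable {X Y : Type*} [MeasurableSpace X] [MeasurableSpace Y] {μ : Measure X} {η : Measure Y}
  {T : X → Y} {m : X → ℂ}

/-- The measure `|m|² μ` is carried by `T` to `η`, and `m` vanishes almost nowhere. Then
`f ↦ m · (f ∘ T)` is an isometry from `L²(η)` to `L²(μ)`. -/
structure IsWeight (μ : Measure X) (η : Measure Y) (T : X → Y) (m : X → ℂ) : Prop where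
  measurable_map : Measurable T
  measurable_weight : Measurable m
  ne_zero : ∀ᵐ x ∂μ, m x ≠ 0
  lintegral_eq : ∀ g : Y → ℝ≥0∞, Measurable g →
    ∫⁻ x, ‖m x‖ₑ ^ 2 * g (T x) ∂μ = ∫⁻ y, g y ∂η

theorem eLpNorm_two_eq (f : X → ℂ) :
    eLpNorm f 2 μ = (∫⁻ x, ‖f x‖ₑ ^ 2 ∂μ) ^ (1 / 2 : ℝ) := by
  rw [eLpNorm_eq_lintegral_rpow_enorm_toReal (by norm_num) (by norm_num)]
  simp

namespace IsWeight

variable (h : IsWeight μ η T m)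
include h

theorem quasiMeasurePreserving : Measure.QuasiMeasurePreserving T μ η := by
  refine ⟨h.measurable_map, Measure.AbsolutelyContinuous.mk fun s hs h0 => ?_⟩
  rw [Measure.map_apply h.measurable_map hs]
  have h1 := h.lintegral_eq (s.indicator 1) (measurable_one.indicator hs)
  rw [lintegral_indicator_one hs, h0, lintegral_eq_zero_iff (by
    have := h.measurable_weight
    have := (measurable_one.indicator hs : Measurable (s.indicator (1 : Y → ℝ≥0∞))).comp
      h.measurable_map
    simp only [Function.comp_def] at this
    fun_prop)] at h1
  rw [measure_eq_zero_iff_ae_notMem]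
  filter_upwards [h1, h.ne_zero] with x hx hm hxs
  have hxs' : T x ∈ s := hxs
  simp [hxs', hm] at hx

theorem lintegral_eq' (g : Y → ℝ≥0∞) (hg : AEMeasurable g η) :
    ∫⁻ x, ‖m x‖ₑ ^ 2 * g (T x) ∂μ = ∫⁻ y, g y ∂η := by
  rw [lintegral_congr_ae hg.ae_eq_mk, ← h.lintegral_eq _ hg.measurable_mk]
  refine lintegral_congr_ae ?_
  filter_upwards [h.quasiMeasurePreserving.ae hg.ae_eq_mk] with x hx
  rw [hx]

theorem eLpNorm_eq (f : Y → ℂ) (hf : AEStronglyMeasurable f η) :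
    eLpNorm (fun x => m x * f (T x)) 2 μ = eLpNorm f 2 η := by
  rw [eLpNorm_two_eq, eLpNorm_two_eq, ← h.lintegral_eq' _ (hf.enorm.pow_const 2)]
  simp only [enorm_mul, mul_pow]

theorem memLp {f : Y → ℂ} (hf : MemLp f 2 η) : MemLp (fun x => m x * f (T x)) 2 μ := by
  refine ⟨h.measurable_weight.aestronglyMeasurable.mul
    (hf.1.comp_quasiMeasurePreserving h.quasiMeasurePreserving), ?_⟩
  rw [h.eLpNorm_eq f hf.1]
  exact hf.2

omit h in
/-- The isometry `f ↦ m · (f ∘ T)` from `L²(η)` to `L²(μ)`. -/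
def comp (h : IsWeight μ η T m) : Lp ℂ 2 η →ₗᵢ[ℂ] Lp ℂ 2 μ where
  toFun f := (h.memLp (Lp.memLp f)).toLp _
  map_add' f g := by
    apply Lp.ext
    filter_upwards [MemLp.coeFn_toLp (h.memLp (Lp.memLp (f + g))),
      MemLp.coeFn_toLp (h.memLp (Lp.memLp f)), MemLp.coeFn_toLp (h.memLp (Lp.memLp g)),
      Lp.coeFn_add ((h.memLp (Lp.memLp f)).toLp _) ((h.memLp (Lp.memLp g)).toLp _),
      h.quasiMeasurePreserving.ae (Lp.coeFn_add f g)] with x h1 h2 h3 h4 h5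
    rw [h1, h4, Pi.add_apply, h2, h3, h5, Pi.add_apply, mul_add]
  map_smul' r f := by
    apply Lp.ext
    filter_upwards [MemLp.coeFn_toLp (h.memLp (Lp.memLp (r • f))),
      MemLp.coeFn_toLp (h.memLp (Lp.memLp f)),
      Lp.coeFn_smul r ((h.memLp (Lp.memLp f)).toLp _),
      h.quasiMeasurePreserving.ae (Lp.coeFn_smul r f)] with x h1 h2 h4 h5
    rw [h1, RingHom.id_apply, h4, Pi.smul_apply, h2, h5, Pi.smul_apply, smul_eq_mul, smul_eq_mul,
      mul_left_comm]
  norm_map' f := by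
    change ‖(h.memLp (Lp.memLp f)).toLp _‖ = _
    rw [Lp.norm_toLp, h.eLpNorm_eq _ (Lp.aestronglyMeasurable f), Lp.norm_def]

theorem coeFn_comp (f : Lp ℂ 2 η) : h.comp f =ᵐ[μ] fun x => m x * f (T x) :=
  MemLp.coeFn_toLp (h.memLp (Lp.memLp f))

theorem comp_surjective {S : Y → X} (hS : Measurable S) (hST : ∀ x, S (T x) = x) :
    Function.Surjective h.comp := by
  intro f
  obtain ⟨f', hf'm, hf'⟩ := Lp.aestronglyMeasurable f
  -- Divide a measurable representative by the weight and transport it back along the left inverse.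
  set q : Y → ℂ := fun y => f' (S y) / m (S y) with hq
  have hqm : StronglyMeasurable q :=
    ((hf'm.measurable.div h.measurable_weight).comp hS).stronglyMeasurable
  have hmq : (fun x => m x * q (T x)) =ᵐ[μ] f := by
    filter_upwards [h.ne_zero, hf'] with x hx hx'
    rw [hq, hx']
    simp only [hST]
    rw [mul_div_cancel₀ _ hx]
  have hqL : MemLp q 2 η := by
    refine ⟨hqm.aestronglyMeasurable, ?_⟩
    rw [← h.eLpNorm_eq q hqm.aestronglyMeasurable, eLpNorm_congr_ae hmq]
    exact (Lp.memLp f).2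
  refine ⟨hqL.toLp q, Lp.ext ?_⟩
  filter_upwards [h.coeFn_comp (hqL.toLp q), hmq,
    h.quasiMeasurePreserving.ae hqL.coeFn_toLp] with x h1 h2 h3
  rw [h1, h3, h2]

omit h in
/-- If `T` has a measurable left inverse, then `f ↦ m · (f ∘ T)` is unitary. -/
def equiv (h : IsWeight μ η T m) {S : Y → X} (hS : Measurable S) (hST : ∀ x, S (T x) = x) :
    Lp ℂ 2 η ≃ₗᵢ[ℂ] Lp ℂ 2 μ :=
  LinearIsometryEquiv.ofSurjective h.comp (h.comp_surjective hS hST)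

theorem coeFn_equiv {S : Y → X} (hS : Measurable S) (hST : ∀ x, S (T x) = x) (f : Lp ℂ 2 η) :
    h.equiv hS hST f =ᵐ[μ] fun x => m x * f (T x) :=
  h.coeFn_comp f

end IsWeight

end WeightedComposition

/-! ### The big cell `t ↦ w n[t]` and changes of variables -/

theorem coe_weyl_mul_shear (t : ℝ) : (weylMatrix * shearMatrix t).1 = !![0, 1; -1, -t] := by
  rw [Matrix.SpecialLinearGroup.coe_mul, coe_weylMatrix, coe_shearMatrix]
  simp

theorem w_mul_n_eq (t : ℝ) : w * n t = mk (weylMatrix * shearMatrix t) := rfl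

theorem bottom_weyl_mul_shear (t : ℝ) :
    bottom (weylMatrix * shearMatrix t) = -(t : ℂ) + Complex.I := by
  rw [bottom, coe_weyl_mul_shear]
  simp

theorem one_add_sq_pos (t : ℝ) : 0 < 1 + t ^ 2 := by positivity

theorem height_w_mul_n (t : ℝ) : height (w * n t) = (1 + t ^ 2)⁻¹ := by
  rw [w_mul_n_eq, height_mk, bottom_weyl_mul_shear, Complex.normSq_apply]
  congr 1
  simp
  ring

/-- The angle of `w n[t]`. -/
def lineAngle (t : ℝ) : AddCircle Real.pi := ((Real.pi / 2 + Real.arctan t : ℝ) : AddCircle Real.pi)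

theorem continuous_lineAngle : Continuous lineAngle :=
  (AddCircle.continuous_mk' Real.pi).comp (continuous_const.add Real.continuous_arctan)

theorem angle_w_mul_n (t : ℝ) : angle (w * n t) = lineAngle t := by
  have hb : bottom (weylMatrix * shearMatrix t)
      = (√(1 + t ^ 2) : ℝ) * bottom (rotMatrix (Real.pi / 2 + Real.arctan t)) := by
    have h0 : (√(1 + t ^ 2) : ℂ) ≠ 0 := by
      exact_mod_cast (Real.sqrt_pos.2 (one_add_sq_pos t)).ne'
    rw [bottom_rotMatrix, Complex.exp_mul_I, ← Complex.ofReal_cos, ← Complex.ofReal_sin,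
      add_comm (Real.pi / 2), Real.cos_add_pi_div_two, Real.sin_add_pi_div_two, Real.sin_arctan,
      Real.cos_arctan, bottom_weyl_mul_shear]
    push_cast
    field_simp
  rw [w_mul_n_eq, angle_of_bottom_eq hb, ← k_eq, angle_k, lineAngle]

/-- Integration over the circle in the coordinate `t` of the big cell. -/
theorem lintegral_lineAngle (g : AddCircle Real.pi → ℝ≥0∞) :
    ∫⁻ t, ENNReal.ofReal (height (w * n t)) * g (lineAngle t)
      = ∫⁻ z, g z := by
  have himg : (fun t => Real.pi / 2 + Real.arctan t) '' Set.univ = Set.Ioo 0 Real.pi := by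
    have h1 : (fun t => Real.pi / 2 + Real.arctan t) '' Set.univ
        = (fun x => Real.pi / 2 + x) '' (Set.range Real.arctan) := by
      rw [Set.image_univ, ← Set.range_comp]; rfl
    rw [h1, Real.range_arctan, Set.image_const_add_Ioo]
    congr 1 <;> ring
  have hcov := lintegral_image_eq_lintegral_abs_deriv_mul (s := Set.univ)
    (f := fun t => Real.pi / 2 + Real.arctan t) (f' := fun t => 1 / (1 + t ^ 2)) MeasurableSet.univ
    (fun t _ => ((Real.hasDerivAt_arctan t).const_add _).hasDerivWithinAt)
    (fun x _ y _ hxy => Real.arctan_injective (add_left_cancel hxy))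
    (fun x => g (x : AddCircle Real.pi))
  have h0 := AddCircle.lintegral_preimage Real.pi 0 g
  rw [zero_add] at h0
  rw [← h0, ← restrict_Ioo_eq_restrict_Ioc, ← himg, hcov, Measure.restrict_univ]
  refine lintegral_congr fun t => ?_
  rw [height_w_mul_n, abs_of_pos (by positivity), one_div]
  rfl

/-- Invariance of Lebesgue measure under Möbius transformations. -/
theorem lintegral_mobius {A B C D : ℝ} (hdet : A * D - B * C = 1) (g : ℝ → ℝ≥0∞) :
    ∫⁻ t, ENNReal.ofReal (((A + t * C) ^ 2)⁻¹) * g ((B + t * D) / (A + t * C)) = ∫⁻ t, g t := by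
  set s : Set ℝ := {t | A + t * C ≠ 0} with hs
  have hsm : MeasurableSet s :=
    (isOpen_ne.preimage (by fun_prop : Continuous fun t : ℝ => A + t * C)).measurableSet
  have hsub : sᶜ.Subsingleton := by
    intro x hx y hy
    simp only [hs, Set.mem_compl_iff, Set.mem_ofPred_eq, not_not] at hx hy
    have hC : C ≠ 0 := by
      rintro rfl
      have hA : A = 0 := by simpa using hx
      rw [hA] at hdet
      simp at hdet
    exact mul_right_cancel₀ hC (by linarith)
  have hsae : s =ᵐ[volume] (Set.univ : Set ℝ) := by
    rw [ae_eq_univ]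
    exact hsub.measure_zero volume
  have hcov := lintegral_image_eq_lintegral_abs_deriv_mul (s := s)
    (f := fun t => (B + t * D) / (A + t * C)) (f' := fun t => ((A + t * C) ^ 2)⁻¹) hsm
    (fun t ht => by
      have h1 : HasDerivAt (fun t => B + t * D) D t := by
        simpa using ((hasDerivAt_id t).mul_const D).const_add B
      have h2 : HasDerivAt (fun t => A + t * C) C t := by
        simpa using ((hasDerivAt_id t).mul_const C).const_add A
      have h3 := h1.div h2 ht
      refine (h3.congr_deriv ?_).hasDerivWithinAt
      rw [inv_eq_one_div]
      congr 1
      linear_combination hdet)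
    (fun x hx y hy hxy => by
      have hx' : A + x * C ≠ 0 := hx
      have hy' : A + y * C ≠ 0 := hy
      have h1 : (B + x * D) / (A + x * C) = (B + y * D) / (A + y * C) := hxy
      rw [div_eq_div_iff hx' hy'] at h1
      linear_combination h1 - (x - y) * hdet) g
  have himg : ((fun t => (B + t * D) / (A + t * C)) '' s : Set ℝ) =ᵐ[volume] Set.univ := by
    rw [ae_eq_univ]
    refine Set.Subsingleton.measure_zero (fun x hx y hy => ?_) volume
    -- The only value that can be missed is `D / C`, the image of infinity.
    have key : ∀ v, v ∉ (fun t => (B + t * D) / (A + t * C)) '' s → D - v * C = 0 := by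
      intro v hv
      by_contra hne
      apply hv
      have h2 : A + (v * A - B) / (D - v * C) * C = 1 / (D - v * C) := by
        field_simp
        linear_combination hdet
      refine ⟨(v * A - B) / (D - v * C), ?_, ?_⟩
      · change A + (v * A - B) / (D - v * C) * C ≠ 0
        rw [h2]
        exact one_div_ne_zero hne
      · simp only [h2]
        field_simp
        linear_combination v * hdet
    have hx' := key x hx
    have hy' := key y hy
    have hC : C ≠ 0 := by
      rintro rfl
      have hD : D = 0 := by simpa using hx'
      rw [hD] at hdet
      simp at hdet
    exact mul_right_cancel₀ hC (by linarith)
  rw [← setLIntegral_univ (μ := volume) g, ← setLIntegral_congr himg, hcov,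
    setLIntegral_congr hsae, setLIntegral_univ]
  refine lintegral_congr fun t => ?_
  rw [abs_of_nonneg (by positivity)]

/-- The measure on the circle obtained from the coordinate `θ` of `k[θ] h`: the Jacobian is the
height. -/
theorem lintegral_angle_rot_mul (h : G) (g : AddCircle Real.pi → ℝ≥0∞) :
    ∫⁻ z, ENNReal.ofReal (height (rot z * h)) * g (angle (rot z * h)) = ∫⁻ z, g z := by
  rw [← lintegral_lineAngle, ← lintegral_lineAngle g]
  obtain ⟨h, rfl⟩ := mk_surjective h
  have hdet : h.1 0 0 * h.1 1 1 - h.1 0 1 * h.1 1 0 = 1 := by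
    rw [← Matrix.det_fin_two]; exact h.2
  rw [← lintegral_mobius hdet fun t => ENNReal.ofReal (height (w * n t)) * g (lineAngle t)]
  refine lintegral_congr_ae ?_
  have hae : ∀ᵐ t : ℝ, h.1 0 0 + t * h.1 1 0 ≠ 0 := by
    by_cases hC : h.1 1 0 = 0
    · refine Filter.Eventually.of_forall fun t => ?_
      intro h0
      rw [hC, mul_zero, add_zero] at h0
      rw [hC, h0] at hdet
      simp at hdet
    · filter_upwards [Measure.ae_ne volume (-h.1 0 0 / h.1 1 0)] with t ht h0
      apply ht
      rw [eq_div_iff hC]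
      linarith
  filter_upwards [hae] with t ht
  set t' := (h.1 0 1 + t * h.1 1 1) / (h.1 0 0 + t * h.1 1 0) with ht'
  have hb : bottom (weylMatrix * shearMatrix t * h)
      = (h.1 0 0 + t * h.1 1 0 : ℝ) * bottom (weylMatrix * shearMatrix t') := by
    have h1 : (h.1 0 0 + t * h.1 1 0) * t' = h.1 0 1 + t * h.1 1 1 := by
      rw [ht', mul_div_cancel₀ _ ht]
    have h1c : (h.1 0 0 + t * h.1 1 0 : ℂ) * t' = h.1 0 1 + t * h.1 1 1 := by exact_mod_cast h1
    rw [bottom_weyl_mul_shear, bottom, Matrix.SpecialLinearGroup.coe_mul, coe_weyl_mul_shear]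
    simp [Matrix.mul_apply, Fin.sum_univ_two]
    linear_combination h1c
  have h2 := height_mul (w * n t) (mk h)
  have h3 := angle_mul (w * n t) (mk h)
  rw [angle_w_mul_n] at h2 h3
  rw [← mul_assoc, ← ENNReal.ofReal_mul (height_pos _).le, ← h2, ← h3, w_mul_n_eq, ← mk_mul,
    height_of_bottom_eq hb, angle_of_bottom_eq hb, ENNReal.ofReal_mul (by positivity), mul_assoc,
    ← w_mul_n_eq, angle_w_mul_n]

/-! ### The three weighted compositions -/

theorem norm_height_cpow {y : ℝ} (hy : 0 < y) {ν : ℂ} (hν : ν.re = 0) :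
    ‖(y : ℂ) ^ (ν + 1 / 2)‖ = √y := by
  rw [Complex.norm_cpow_eq_rpow_re_of_pos hy, Real.sqrt_eq_rpow]
  simp [hν]

theorem enorm_sq_eq_ofReal {z : ℂ} {y : ℝ} (hy : 0 ≤ y) (hz : ‖z‖ = √y) :
    ‖z‖ₑ ^ 2 = ENNReal.ofReal y := by
  rw [← ofReal_norm, ← ENNReal.ofReal_pow (norm_nonneg _), hz, Real.sq_sqrt hy]

theorem cpow_ne_zero_of_pos {y : ℝ} (hy : 0 < y) (s : ℂ) : (y : ℂ) ^ s ≠ 0 := by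
  rw [Complex.cpow_ne_zero_iff]
  exact Or.inl (by exact_mod_cast hy.ne')

theorem lintegral_haarAddCircle (g : AddCircle Real.pi → ℝ≥0∞) :
    ∫⁻ z, g z ∂AddCircle.haarAddCircle = (ENNReal.ofReal Real.pi)⁻¹ * ∫⁻ z, g z := by
  rw [AddCircle.volume_eq_smul_haarAddCircle, lintegral_smul_measure, smul_eq_mul, ← mul_assoc,
    ENNReal.inv_mul_cancel (by simp [Real.pi_pos]) ENNReal.ofReal_ne_top, one_mul]

/-- The factor `y(k[θ] h)^{ν + 1/2}` in the action of right translation by `h` on functions on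
the circle. -/
def translateWeight (ν : ℂ) (h : G) (z : AddCircle Real.pi) : ℂ :=
  ((height (rot z * h) : ℝ) : ℂ) ^ (ν + 1 / 2)

theorem continuous_rot_mul (h : G) : Continuous fun z => rot z * h :=
  continuous_rot.mul continuous_const

theorem isWeight_translate {ν : ℂ} (hν : ν.re = 0) (h : G) :
    IsWeight (AddCircle.haarAddCircle (T := Real.pi)) AddCircle.haarAddCircle
      (fun z => angle (rot z * h)) (translateWeight ν h) where
  measurable_map := (continuous_angle.comp (continuous_rot_mul h)).measurable
  measurable_weight := by
    have : Continuous fun z => height (rot z * h) := continuous_height.comp (continuous_rot_mul h)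
    exact (Complex.measurable_ofReal.comp this.measurable).pow_const _
  ne_zero := Filter.Eventually.of_forall fun z => cpow_ne_zero_of_pos (height_pos _) _
  lintegral_eq g _ := by
    simp_rw [translateWeight,
      fun z => enorm_sq_eq_ofReal (height_pos (rot z * h)).le
        (norm_height_cpow (height_pos (rot z * h)) hν)]
    rw [lintegral_haarAddCircle, lintegral_haarAddCircle, lintegral_angle_rot_mul]

/-- The factor `π^{-1/2} (1 + t²)^{-(ν + 1/2)}` in the passage from the circle to the line;
`π` enters because the Haar measure of the circle has total mass one. -/
def lineWeight (ν : ℂ) (t : ℝ) : ℂ :=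
  ((√Real.pi)⁻¹ : ℝ) * ((height (w * n t) : ℝ) : ℂ) ^ (ν + 1 / 2)

theorem measurable_height_w_mul_n : Measurable fun t => height (w * n t) := by
  simp_rw [height_w_mul_n]
  fun_prop

theorem isWeight_line {ν : ℂ} (hν : ν.re = 0) :
    IsWeight volume (AddCircle.haarAddCircle (T := Real.pi)) lineAngle (lineWeight ν) where
  measurable_map := continuous_lineAngle.measurable
  measurable_weight :=
    ((Complex.measurable_ofReal.comp measurable_height_w_mul_n).pow_const _).const_mul _
  ne_zero := Filter.Eventually.of_forall fun t =>
    mul_ne_zero (by simp [Real.sqrt_ne_zero'.2 Real.pi_pos])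
      (cpow_ne_zero_of_pos (height_pos _) _)
  lintegral_eq g _ := by
    have h1 : ∀ t, ‖lineWeight ν t‖ₑ ^ 2
        = (ENNReal.ofReal Real.pi)⁻¹ * ENNReal.ofReal (height (w * n t)) := by
      intro t
      rw [lineWeight, enorm_mul, mul_pow, enorm_sq_eq_ofReal (height_pos (w * n t)).le
        (norm_height_cpow (height_pos (w * n t)) hν),
        enorm_sq_eq_ofReal (y := Real.pi⁻¹) (by positivity), ENNReal.ofReal_inv_of_pos Real.pi_pos]
      rw [Complex.norm_real, Real.norm_of_nonneg (by positivity), Real.sqrt_inv]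
    simp_rw [h1, mul_assoc]
    rw [lintegral_const_mul' _ _ (by simp [Real.pi_pos]), lintegral_lineAngle,
      lintegral_haarAddCircle]

/-- A measurable left inverse of `lineAngle`: `θ ↦ tan (θ - π/2)` for `θ ∈ (0, π]`. -/
def lineCoord (z : AddCircle Real.pi) : ℝ :=
  Real.tan (((AddCircle.equivIoc Real.pi 0) z : ℝ) - Real.pi / 2)

theorem measurable_lineCoord : Measurable lineCoord := by
  have h1 : Measurable fun z : AddCircle Real.pi => ((AddCircle.equivIoc Real.pi 0) z : ℝ) :=
    measurable_subtype_coe.comp (AddCircle.measurableEquivIoc Real.pi 0).measurable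
  have h2 : Measurable Real.tan := by
    have : Real.tan = fun x => Real.sin x / Real.cos x := funext Real.tan_eq_sin_div_cos
    rw [this]
    fun_prop
  exact h2.comp (h1.sub_const _)

theorem lineCoord_lineAngle (t : ℝ) : lineCoord (lineAngle t) = t := by
  have h1 := Real.neg_pi_div_two_lt_arctan t
  have h2 := Real.arctan_lt_pi_div_two t
  rw [lineCoord, lineAngle, AddCircle.equivIoc_coe_of_mem, add_sub_cancel_left, Real.tan_arctan]
  constructor <;> linarith

/-- The factor `π^{1/2} |u|^{1/2 - ν}` in the passage from Lebesgue measure to `π⁻¹ d^×u`. It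
vanishes at `u = 0`, a null set. -/
def kirillovWeight (ν : ℂ) (u : ℝ) : ℂ := (√Real.pi : ℝ) * ((|u| : ℝ) : ℂ) ^ (-ν + 1 / 2)

theorem ae_ne_zero_mulMeasure : ∀ᵐ u ∂mulMeasure, u ≠ 0 := by
  refine (withDensity_absolutelyContinuous _ _).ae_le ?_
  exact ae_restrict_mem (measurableSet_singleton (0 : ℝ)).compl

theorem mulMeasure_absolutelyContinuous : mulMeasure ≪ volume :=
  (withDensity_absolutelyContinuous _ _).trans
    (Measure.absolutelyContinuous_of_le Measure.restrict_le_self)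

theorem isWeight_kirillov {ν : ℂ} (hν : ν.re = 0) :
    IsWeight mulMeasure volume id (kirillovWeight ν) where
  measurable_map := measurable_id
  measurable_weight := by
    have : Measurable fun u : ℝ => |u| := measurable_abs
    exact ((Complex.measurable_ofReal.comp this).pow_const _).const_mul _
  ne_zero := by
    filter_upwards [ae_ne_zero_mulMeasure] with u hu
    exact mul_ne_zero (by simp [Real.sqrt_ne_zero'.2 Real.pi_pos])
      (cpow_ne_zero_of_pos (abs_pos.2 hu) _)
  lintegral_eq g hg := by
    have hm : Measurable fun u : ℝ => ENNReal.ofReal (1 / (Real.pi * |u|)) := by fun_prop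
    have h0 : ∀ u : ℝ, u ≠ 0 → ‖kirillovWeight ν u‖ₑ ^ 2 = ENNReal.ofReal (Real.pi * |u|) := by
      intro u hu
      have hν' : (-ν).re = 0 := by simp [hν]
      refine enorm_sq_eq_ofReal (by positivity) ?_
      rw [kirillovWeight, norm_mul, norm_height_cpow (abs_pos.2 hu) hν', Complex.norm_real,
        Real.norm_of_nonneg (by positivity), Real.sqrt_mul Real.pi_pos.le]
    have h1 : ∫⁻ u, ‖kirillovWeight ν u‖ₑ ^ 2 * g (id u) ∂mulMeasure
        = ∫⁻ u, ENNReal.ofReal (Real.pi * |u|) * g u ∂mulMeasure := by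
      refine lintegral_congr_ae ?_
      filter_upwards [ae_ne_zero_mulMeasure] with u hu
      rw [h0 u hu, id]
    rw [h1, mulMeasure, lintegral_withDensity_eq_lintegral_mul _ hm (by fun_prop)]
    have h2 : ∫⁻ u in ({0}ᶜ : Set ℝ), ((fun u : ℝ => ENNReal.ofReal (1 / (Real.pi * |u|))) *
        fun u => ENNReal.ofReal (Real.pi * |u|) * g u) u = ∫⁻ u in ({0}ᶜ : Set ℝ), g u := by
      refine setLIntegral_congr_fun (measurableSet_singleton (0 : ℝ)).compl fun u hu => ?_
      have hu' : 0 < Real.pi * |u| := mul_pos Real.pi_pos (abs_pos.2 hu)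
      simp only [Pi.mul_apply]
      rw [← mul_assoc, ← ENNReal.ofReal_mul (by positivity), one_div, inv_mul_cancel₀ hu'.ne',
        ENNReal.ofReal_one, one_mul]
    rw [h2]
    refine (setLIntegral_congr ?_).trans (setLIntegral_univ g)
    rw [ae_eq_univ, compl_compl]
    exact measure_singleton 0

/-! ### Right translation -/

theorem angle_rot_mul_mul (g h : G) (z : AddCircle Real.pi) :
    angle (rot z * (g * h)) = angle (rot (angle (rot z * g)) * h) := by
  rw [← mul_assoc, angle_mul]

theorem translateWeight_mul (ν : ℂ) (g h : G) (z : AddCircle Real.pi) :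
    translateWeight ν (g * h) z
      = translateWeight ν g z * translateWeight ν h (angle (rot z * g)) := by
  rw [translateWeight, translateWeight, translateWeight, ← mul_assoc, height_mul,
    Complex.ofReal_mul, Complex.mul_cpow_ofReal_nonneg (height_pos _).le (height_pos _).le]

/-- Right translation by `h` on `L²(ℝ/πℤ)`, for functions extended to `G` with weight `ν`. -/
def circleTranslate {ν : ℂ} (hν : ν.re = 0) (h : G) :
    Lp ℂ 2 (AddCircle.haarAddCircle (T := Real.pi)) ≃ₗᵢ[ℂ]
      Lp ℂ 2 (AddCircle.haarAddCircle (T := Real.pi)) :=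
  (isWeight_translate hν h).equiv (S := fun z => angle (rot z * h⁻¹))
    (continuous_angle.comp (continuous_rot_mul h⁻¹)).measurable
    (fun z => by rw [← angle_rot_mul_mul, mul_inv_cancel, mul_one, angle_rot])

theorem coeFn_circleTranslate {ν : ℂ} (hν : ν.re = 0) (h : G)
    (f : Lp ℂ 2 (AddCircle.haarAddCircle (T := Real.pi))) :
    circleTranslate hν h f =ᵐ[AddCircle.haarAddCircle]
      fun z => translateWeight ν h z * f (angle (rot z * h)) :=
  (isWeight_translate hν h).coeFn_equiv _ _ f

theorem circleTranslate_one {ν : ℂ} (hν : ν.re = 0)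
    (f : Lp ℂ 2 (AddCircle.haarAddCircle (T := Real.pi))) : circleTranslate hν 1 f = f := by
  apply Lp.ext
  filter_upwards [coeFn_circleTranslate hν 1 f] with z hz
  rw [hz, translateWeight, mul_one, angle_rot, height_rot]
  simp

theorem circleTranslate_mul {ν : ℂ} (hν : ν.re = 0) (g h : G)
    (f : Lp ℂ 2 (AddCircle.haarAddCircle (T := Real.pi))) :
    circleTranslate hν (g * h) f = circleTranslate hν g (circleTranslate hν h f) := by
  apply Lp.ext
  filter_upwards [coeFn_circleTranslate hν (g * h) f,
    coeFn_circleTranslate hν g (circleTranslate hν h f),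
    (isWeight_translate hν g).quasiMeasurePreserving.ae (coeFn_circleTranslate hν h f)]
    with z h1 h2 h3
  rw [h1, h2, h3, translateWeight_mul, angle_rot_mul_mul, mul_assoc]

/-- The function on the circle with Fourier coefficients `c`. -/
def circleFun : U ≃ₗᵢ[ℂ] Lp ℂ 2 (AddCircle.haarAddCircle (T := Real.pi)) :=
  (fourierBasis (T := Real.pi)).repr.symm

/-- Right translation, as a representation on `U_ν` in terms of coefficient sequences. -/
def translate {ν : ℂ} (hν : ν.re = 0) : G →* (U ≃ₗᵢ[ℂ] U) where
  toFun h := circleFun.trans ((circleTranslate hν h).trans circleFun.symm)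
  map_one' := by
    ext1 c
    change circleFun.symm (circleTranslate hν 1 (circleFun c)) = c
    rw [circleTranslate_one, LinearIsometryEquiv.symm_apply_apply]
  map_mul' g h := by
    ext1 c
    change circleFun.symm (circleTranslate hν (g * h) (circleFun c)) = circleFun.symm
      (circleTranslate hν g (circleFun (circleFun.symm (circleTranslate hν h (circleFun c)))))
    rw [circleTranslate_mul, LinearIsometryEquiv.apply_symm_apply]

theorem circleFun_translate {ν : ℂ} (hν : ν.re = 0) (h : G) (c : U) :
    circleFun (translate hν h c) = circleTranslate hν h (circleFun c) := by
  change circleFun (circleFun.symm (circleTranslate hν h (circleFun c))) = _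
  rw [LinearIsometryEquiv.apply_symm_apply]

theorem ae_volume_circle_iff {P : AddCircle Real.pi → Prop} :
    (∀ᵐ z, P z) ↔ ∀ᵐ z ∂AddCircle.haarAddCircle (T := Real.pi), P z := by
  rw [AddCircle.volume_eq_smul_haarAddCircle, Measure.ae_ennreal_smul_measure_iff]
  simp [Real.pi_pos]

/-- Almost every `θ ∈ ℝ` means almost every `θ ∈ ℝ/πℤ`. -/
theorem ae_real_iff_ae_circle {P : AddCircle Real.pi → Prop} (hP : MeasurableSet {z | P z}) :
    (∀ᵐ θ : ℝ, P (θ : AddCircle Real.pi)) ↔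
      ∀ᵐ z ∂AddCircle.haarAddCircle (T := Real.pi), P z := by
  rw [← ae_volume_circle_iff]
  have key : ∀ t : ℝ, (∀ᵐ z : AddCircle Real.pi, P z) ↔
      ∀ᵐ θ : ℝ ∂volume.restrict (Set.Ioc t (t + Real.pi)), P (θ : AddCircle Real.pi) := by
    intro t
    have hmp := AddCircle.measurePreserving_mk Real.pi t
    have h := ae_map_iff (μ := volume.restrict (Set.Ioc t (t + Real.pi)))
      hmp.measurable.aemeasurable hP
    rwa [hmp.map_eq] at h
  constructor
  · intro h
    rw [key 0]
    exact ae_restrict_of_ae h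
  · intro h
    rw [← Measure.restrict_univ (μ := (volume : Measure ℝ)),
      ← iUnion_Ioc_add_zsmul Real.pi_pos 0, ae_restrict_iUnion_iff]
    intro j
    have := (key (0 + j • Real.pi)).1 h
    rwa [add_assoc, ← add_one_zsmul] at this

theorem isRightTranslate_iff {ν : ℂ} (hν : ν.re = 0) (h : G) (c c' : U) :
    IsRightTranslate ν h c c' ↔ c' = translate hν h c := by
  set F := circleFun c with hF
  set F' := circleFun c' with hF'
  have hmeas : MeasurableSet {z | F' z = translateWeight ν h z * F (angle (rot z * h))} :=
    measurableSet_eq_fun (Lp.stronglyMeasurable F').measurable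
      ((isWeight_translate hν h).measurable_weight.mul ((Lp.stronglyMeasurable F).measurable.comp
        (isWeight_translate hν h).measurable_map))
  have h1 : ∀ (x y θ : ℝ), 0 < y →
      (toFun ν c' (n x * a y * k θ) = toFun ν c (n x * a y * k θ * h) ↔
        F' (θ : AddCircle Real.pi) = translateWeight ν h θ * F (angle (rot θ * h))) := by
    intro x y θ hy
    have hL : toFun ν c' (n x * a y * k θ)
        = (y : ℂ) ^ (ν + 1 / 2) * F' (θ : AddCircle Real.pi) := by
      rw [toFun, height_n_a_mul x hy, angle_n_a_mul x hy, height_k, angle_k, mul_one]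
      rfl
    have hR : toFun ν c (n x * a y * k θ * h)
        = (y : ℂ) ^ (ν + 1 / 2) * (translateWeight ν h θ * F (angle (rot θ * h))) := by
      rw [toFun, mul_assoc (n x * a y), height_n_a_mul x hy, angle_n_a_mul x hy, translateWeight,
        rot_coe, Complex.ofReal_mul, Complex.mul_cpow_ofReal_nonneg hy.le (height_pos _).le,
        mul_assoc]
      rfl
    rw [hL, hR]
    exact mul_right_inj' (cpow_ne_zero_of_pos hy _)
  have h2 : c' = translate hν h c ↔ F' = circleTranslate hν h F := by
    rw [hF, hF', ← circleFun_translate, circleFun.injective.eq_iff]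
  have h3 : F' = circleTranslate hν h F ↔ ∀ᵐ z ∂AddCircle.haarAddCircle (T := Real.pi),
      F' z = translateWeight ν h z * F (angle (rot z * h)) := by
    rw [Lp.ext_iff]
    constructor
    · intro H
      exact H.trans (coeFn_circleTranslate hν h F)
    · intro H
      exact Filter.EventuallyEq.trans H (coeFn_circleTranslate hν h F).symm
  rw [h2, h3, ← ae_real_iff_ae_circle hmeas]
  constructor
  · intro H
    filter_upwards [H 0 1 one_pos] with θ hθ
    exact (h1 0 1 θ one_pos).1 hθ
  · intro H x y hy
    filter_upwards [H] with θ hθ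
    exact (h1 x y θ hy).2 hθ

/-! ### Strong continuity -/

/-- The right translate of a continuous function, as a continuous function on the circle
depending continuously on the translation. -/
def translateContinuous (ν : ℂ) (φ : C(AddCircle Real.pi, ℂ)) : C(G, C(AddCircle Real.pi, ℂ)) :=
  ContinuousMap.curry ⟨fun q : G × AddCircle Real.pi =>
    translateWeight ν q.1 q.2 * φ (angle (rot q.2 * q.1)), by
      have h1 : Continuous fun q : G × AddCircle Real.pi => rot q.2 * q.1 :=
        (continuous_rot.comp continuous_snd).mul continuous_fst
      have h2 : Continuous fun q : G × AddCircle Real.pi => translateWeight ν q.1 q.2 :=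
        (Complex.continuous_ofReal.comp (continuous_height.comp h1)).cpow continuous_const
          fun q => Complex.ofReal_mem_slitPlane.2 (height_pos _)
      exact h2.mul (φ.continuous.comp (continuous_angle.comp h1))⟩

theorem circleTranslate_toLp {ν : ℂ} (hν : ν.re = 0) (h : G) (φ : C(AddCircle Real.pi, ℂ)) :
    circleTranslate hν h (ContinuousMap.toLp 2 AddCircle.haarAddCircle ℂ φ)
      = ContinuousMap.toLp 2 AddCircle.haarAddCircle ℂ (translateContinuous ν φ h) := by
  apply Lp.ext
  filter_upwards [coeFn_circleTranslate hν h (ContinuousMap.toLp 2 AddCircle.haarAddCircle ℂ φ),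
    ContinuousMap.coeFn_toLp (p := 2) (𝕜 := ℂ) AddCircle.haarAddCircle (translateContinuous ν φ h),
    (isWeight_translate hν h).quasiMeasurePreserving.ae
      (ContinuousMap.coeFn_toLp (p := 2) (𝕜 := ℂ) AddCircle.haarAddCircle φ)] with z h1 h2 h3
  rw [h1, h2, h3]
  rfl

theorem continuous_circleTranslate {ν : ℂ} (hν : ν.re = 0)
    (f : Lp ℂ 2 (AddCircle.haarAddCircle (T := Real.pi))) :
    Continuous fun h : G => circleTranslate hν h f := by
  refine continuous_of_uniform_approx_of_continuous fun u hu => ?_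
  obtain ⟨ε, hε, hεu⟩ := Metric.mem_uniformity_dist.1 hu
  obtain ⟨φ, hφ⟩ := (ContinuousMap.toLp_denseRange ℂ
    (AddCircle.haarAddCircle (T := Real.pi)) ℂ (p := 2) (by norm_num)).exists_dist_lt f hε
  refine ⟨fun h => circleTranslate hν h (ContinuousMap.toLp 2 AddCircle.haarAddCircle ℂ φ), ?_,
    fun h => hεu ?_⟩
  · simp_rw [circleTranslate_toLp]
    exact (ContinuousMap.toLp 2 AddCircle.haarAddCircle ℂ).continuous.comp
      (translateContinuous ν φ).continuous
  · rwa [LinearIsometryEquiv.dist_map]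

theorem isUnitaryRep_translate {ν : ℂ} (hν : ν.re = 0) : IsUnitaryRep (translate hν) :=
  fun c => circleFun.symm.continuous.comp (continuous_circleTranslate hν (circleFun c))

/-! ### The `L²` Fourier transform of integrable functions -/

open FourierTransform in
/-- On `L¹ ∩ L²` the Plancherel transform is given by the Fourier integral. -/
theorem coeFn_fourierTransform_toLp {f : ℝ → ℂ} (hf : Integrable f) (hf2 : MemLp f 2) :
    (Lp.fourierTransformₗᵢ ℝ ℂ (hf2.toLp f) : ℝ → ℂ) =ᵐ[volume] 𝓕 f := by
  have hcont : Continuous (𝓕 f) := VectorFourier.fourierIntegral_continuous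
    Real.continuous_fourierChar continuous_inner hf
  refine ae_eq_of_integral_contDiff_smul_eq
    ((Lp.memLp (Lp.fourierTransformₗᵢ ℝ ℂ (hf2.toLp f))).locallyIntegrable one_le_two)
    hcont.locallyIntegrable fun g g_smooth g_cpt => ?_
  have hg₁ : HasCompactSupport (Complex.ofRealCLM ∘ g) := g_cpt.comp_left rfl
  have hg₂ : ContDiff ℝ (⊤ : ℕ∞) (Complex.ofRealCLM ∘ g) :=
    Complex.ofRealCLM.contDiff.comp g_smooth
  set φ : SchwartzMap ℝ ℂ := hg₁.toSchwartzMap hg₂ with hφ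
  have hφg : ∀ x, φ x = (g x : ℂ) := fun x => rfl
  -- Both transforms agree with the transform of the tempered distribution defined by `f`.
  have h1 := congrArg (fun T => T φ) (Lp.fourier_toTemperedDistribution_eq (hf2.toLp f))
  simp only [TemperedDistribution.fourier_apply, Lp.toTemperedDistribution_apply] at h1
  have h2 : ∫ x, (𝓕 φ) x • (hf2.toLp f) x = ∫ x, (𝓕 φ) x • f x := by
    refine integral_congr_ae ?_
    filter_upwards [hf2.coeFn_toLp] with x hx
    rw [hx]
  have h3 : ∫ x, (𝓕 (φ : ℝ → ℂ)) x • f x = ∫ x, φ x • (𝓕 f) x := by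
    have h := VectorFourier.integral_fourierIntegral_smul_eq_flip (L := innerₗ ℝ)
      (μ := volume) (ν := volume) Real.continuous_fourierChar continuous_inner φ.integrable hf
    rwa [flip_innerₗ] at h
  rw [h2, SchwartzMap.fourier_coe, h3] at h1
  simp only [hφg, smul_eq_mul] at h1
  simp only [Complex.real_smul]
  exact h1.symm

/-! ### Smooth vectors -/

theorem IsSmooth.summable_abs_mul {c : U} (hc : IsSmooth c) :
    Summable fun p : ℤ => |(p : ℝ)| * ‖c p‖ := by
  obtain ⟨C, hC⟩ := hc 3
  refine Summable.of_nonneg_of_le (fun p => by positivity) (fun p => ?_)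
    ((Real.summable_one_div_int_pow.2 one_lt_two).mul_left C)
  by_cases hp : p = 0
  · simp [hp]
  · have hp' : 0 < |(p : ℝ)| := abs_pos.2 (by exact_mod_cast hp)
    rw [← sq_abs (p : ℝ), mul_one_div, le_div_iff₀ (by positivity)]
    calc |(p : ℝ)| * ‖c p‖ * |(p : ℝ)| ^ 2 = |(p : ℝ)| ^ 3 * ‖c p‖ := by ring
      _ ≤ C := hC p

theorem IsSmooth.summable_norm {c : U} (hc : IsSmooth c) : Summable fun p : ℤ => ‖c p‖ := by
  refine Summable.of_norm_bounded_eventually hc.summable_abs_mul ?_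
  filter_upwards [(Set.finite_singleton (0 : ℤ)).compl_mem_cofinite] with p hp
  have hp' : (1 : ℝ) ≤ |(p : ℝ)| := by
    exact_mod_cast Int.one_le_abs hp
  rw [norm_norm]
  exact le_mul_of_one_le_left (norm_nonneg _) hp'

theorem norm_fourier_apply (p : ℤ) (z : AddCircle Real.pi) : ‖fourier p z‖ = 1 := by
  rw [fourier_apply]
  exact Circle.norm_coe _

/-- The Fourier series `∑ c_p exp(2piθ)` on the circle, summed pointwise. -/
def smoothSum (c : U) (z : AddCircle Real.pi) : ℂ := ∑' p : ℤ, c p * fourier p z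

theorem smoothFun_eq (c : U) (s : ℂ) (g : G) :
    smoothFun c s g = ((height g : ℝ) : ℂ) ^ (s + 1 / 2) * smoothSum c (angle g) := by
  rw [smoothFun, smoothSum, ← tsum_mul_left]
  refine tsum_congr fun p => ?_
  rw [phi]
  ring

theorem norm_smoothSum_le {c : U} (hc : IsSmooth c) (z : AddCircle Real.pi) :
    ‖smoothSum c z‖ ≤ ∑' p, ‖c p‖ := by
  refine tsum_of_norm_bounded hc.summable_norm.hasSum fun p => ?_
  rw [norm_mul, norm_fourier_apply, mul_one]

theorem coeFn_circleFun_eq_smoothSum {c : U} (hc : IsSmooth c) :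
    (circleFun c : AddCircle Real.pi → ℂ) =ᵐ[AddCircle.haarAddCircle] smoothSum c := by
  have hs : Summable fun p : ℤ => c p • (fourier p : C(AddCircle Real.pi, ℂ)) := by
    refine Summable.of_norm ?_
    simp_rw [norm_smul, fourier_norm, mul_one]
    exact hc.summable_norm
  have h1 := hs.hasSum.mapL (ContinuousMap.toLp 2 (AddCircle.haarAddCircle (T := Real.pi)) ℂ)
  have h2 := (fourierBasis (T := Real.pi)).hasSum_repr_symm c
  have h3 : circleFun c = ContinuousMap.toLp 2 (AddCircle.haarAddCircle (T := Real.pi)) ℂ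
      (∑' p, c p • fourier p) := by
    refine HasSum.unique h2 ?_
    convert h1 using 2 with p
    rw [map_smul, coe_fourierBasis]
  rw [h3]
  refine (ContinuousMap.coeFn_toLp _ _).trans (Filter.Eventually.of_forall fun z => ?_)
  rw [smoothSum]
  exact ((hs.hasSum.mapL (ContinuousMap.evalCLM ℂ z)).tsum_eq).symm

/-- The restriction of a smooth series to the big cell. -/
def lineSum (c : U) (t : ℝ) : ℂ := smoothSum c (lineAngle t)

/-- The derivative of `lineSum c` multiplied by `1 + t²`. -/
def lineSumDeriv (c : U) (t : ℝ) : ℂ :=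
  ∑' p : ℤ, c p * (2 * Real.pi * Complex.I * p / Real.pi * fourier p (lineAngle t))

theorem norm_deriv_fourier (p : ℤ) (z : AddCircle Real.pi) (c : ℂ) :
    ‖c * (2 * Real.pi * Complex.I * p / Real.pi * fourier p z)‖ = 2 * (|(p : ℝ)| * ‖c‖) := by
  have hpi : (Real.pi : ℂ) ≠ 0 := by exact_mod_cast Real.pi_ne_zero
  have : (2 * Real.pi * Complex.I * p / Real.pi : ℂ) = 2 * Complex.I * p := by field_simp
  rw [this]
  simp only [norm_mul, norm_fourier_apply, Complex.norm_I, Complex.norm_intCast,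
    Complex.norm_ofNat]
  ring

theorem norm_lineSumDeriv_le {c : U} (hc : IsSmooth c) (t : ℝ) :
    ‖lineSumDeriv c t‖ ≤ ∑' p : ℤ, 2 * (|(p : ℝ)| * ‖c p‖) :=
  tsum_of_norm_bounded (hc.summable_abs_mul.mul_left 2).hasSum fun p =>
    (norm_deriv_fourier p _ _).le

theorem hasDerivAt_lineSum {c : U} (hc : IsSmooth c) (t : ℝ) :
    HasDerivAt (lineSum c) (lineSumDeriv c t * (1 / (1 + t ^ 2) : ℝ)) t := by
  have h1 : ∀ x : ℝ, HasDerivAt (fun x : ℝ => smoothSum c (x : AddCircle Real.pi))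
      (∑' p : ℤ, c p * (2 * Real.pi * Complex.I * p / Real.pi *
        fourier p (x : AddCircle Real.pi))) x := by
    intro x
    refine hasDerivAt_tsum (hc.summable_abs_mul.mul_left 2)
      (fun p y => (hasDerivAt_fourier Real.pi p y).const_mul (c p))
      (fun p y => (norm_deriv_fourier p _ _).le) (y₀ := 0) ?_ x
    refine Summable.of_norm ?_
    simp_rw [norm_mul, norm_fourier_apply, mul_one]
    exact hc.summable_norm
  have h2 := (Real.hasDerivAt_arctan t).const_add (Real.pi / 2)
  have h3 := (h1 (Real.pi / 2 + Real.arctan t)).scomp t h2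
  refine h3.congr_deriv ?_
  rw [Complex.real_smul, mul_comm]
  rfl

theorem continuous_lineSum {c : U} (hc : IsSmooth c) : Continuous (lineSum c) :=
  continuous_iff_continuousAt.2 fun t => (hasDerivAt_lineSum hc t).continuousAt

theorem continuous_lineSumDeriv {c : U} (hc : IsSmooth c) : Continuous (lineSumDeriv c) := by
  refine continuous_tsum (fun p => ?_) (hc.summable_abs_mul.mul_left 2)
    fun p t => (norm_deriv_fourier p _ _).le
  exact continuous_const.mul (continuous_const.mul ((fourier p).continuous.comp
    continuous_lineAngle))

/-! ### The kernel `(1 + t²)^{-(s + 1/2)}` -/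

/-- The kernel `(1 + t²)^{-(s + 1/2)}`. -/
def kernel (s : ℂ) (t : ℝ) : ℂ := Complex.exp (-(s + 1 / 2) * (Real.log (1 + t ^ 2) : ℝ))

theorem height_cpow_eq_kernel (s : ℂ) (t : ℝ) :
    ((height (w * n t) : ℝ) : ℂ) ^ (s + 1 / 2) = kernel s t := by
  have h := height_pos (w * n t)
  rw [kernel, Complex.cpow_def_of_ne_zero (by exact_mod_cast h.ne'), ← Complex.ofReal_log h.le,
    height_w_mul_n, Real.log_inv]
  congr 1
  push_cast
  ring

theorem norm_kernel (s : ℂ) (t : ℝ) : ‖kernel s t‖ = (1 + t ^ 2) ^ (-(s.re + 1 / 2)) := by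
  rw [kernel, Complex.norm_exp, Real.rpow_def_of_pos (one_add_sq_pos t)]
  congr 1
  rw [Complex.re_mul_ofReal]
  simp
  ring

theorem continuous_log_one_add_sq : Continuous fun t : ℝ => Real.log (1 + t ^ 2) :=
  Continuous.log (by fun_prop) fun t => (one_add_sq_pos t).ne'

theorem continuous_kernel (s : ℂ) : Continuous (kernel s) := by
  have := continuous_log_one_add_sq
  unfold kernel
  fun_prop

theorem hasDerivAt_kernel (s : ℂ) (t : ℝ) :
    HasDerivAt (kernel s) (-(2 * s + 1) * (t / (1 + t ^ 2) : ℝ) * kernel s t) t := by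
  have h1 : HasDerivAt (fun t : ℝ => Real.log (1 + t ^ 2)) (2 * t / (1 + t ^ 2)) t := by
    have h0 : HasDerivAt (fun t : ℝ => 1 + t ^ 2) (2 * t) t := by
      simpa using (hasDerivAt_pow 2 t).const_add 1
    exact h0.log (one_add_sq_pos t).ne'
  have h2 := ((h1.ofReal_comp).const_mul (-(s + 1 / 2))).cexp
  refine h2.congr_deriv ?_
  rw [kernel]
  push_cast
  ring

theorem hasDerivAt_kernel_param (s : ℂ) (t : ℝ) :
    HasDerivAt (fun s => kernel s t) (-(Real.log (1 + t ^ 2) : ℝ) * kernel s t) s := by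
  have h2 := ((((hasDerivAt_id s).add_const (1 / 2)).neg).mul_const
    ((Real.log (1 + t ^ 2) : ℝ) : ℂ)).cexp
  refine h2.congr_deriv ?_
  rw [kernel]
  simp
  ring

theorem integrable_one_add_sq_rpow {r : ℝ} (hr : 1 / 2 < r) :
    Integrable fun t : ℝ => (1 + t ^ 2) ^ (-r) := by
  have h := integrable_rpow_neg_one_add_norm_sq (E := ℝ) (μ := volume) (r := 2 * r)
    (by simp; linarith)
  refine h.congr (Filter.Eventually.of_forall fun t => ?_)
  simp only [Real.norm_eq_abs, sq_abs]
  congr 1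
  ring

theorem integrable_kernel_mul {H : ℝ → ℂ} (hH : AEStronglyMeasurable H) {C : ℝ}
    (hC : ∀ t, ‖H t‖ ≤ C * (1 + t ^ 2) ^ (-(1 / 2) : ℝ)) {s : ℂ} (hs : -(1 / 2 : ℝ) < s.re) :
    Integrable fun t => kernel s t * H t := by
  refine ((integrable_one_add_sq_rpow (r := s.re + 1) (by linarith)).const_mul C).mono'
    ((continuous_kernel s).aestronglyMeasurable.mul hH) (Filter.Eventually.of_forall fun t => ?_)
  rw [norm_mul, norm_kernel]
  calc (1 + t ^ 2) ^ (-(s.re + 1 / 2)) * ‖H t‖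
      ≤ (1 + t ^ 2) ^ (-(s.re + 1 / 2)) * (C * (1 + t ^ 2) ^ (-(1 / 2) : ℝ)) := by
        gcongr
        exact hC t
    _ = C * (1 + t ^ 2) ^ (-(s.re + 1)) := by
        rw [mul_left_comm, ← Real.rpow_add (one_add_sq_pos t)]
        congr 2
        ring

/-- Integrals against the kernel depend holomorphically on `s` for `Re s > -1/2`, if the
other factor decays like `1 / |t|`. -/
theorem differentiableOn_integral_kernel {H : ℝ → ℂ} (hH : AEStronglyMeasurable H) {C : ℝ}
    (hC : ∀ t, ‖H t‖ ≤ C * (1 + t ^ 2) ^ (-(1 / 2) : ℝ)) :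
    DifferentiableOn ℂ (fun s => ∫ t, kernel s t * H t) {s | -(1 / 2 : ℝ) < s.re} := by
  intro s hs
  have hs' : -(1 / 2 : ℝ) < s.re := hs
  have hC0 : 0 ≤ C := by simpa using (norm_nonneg _).trans (hC 0)
  -- A third of the distance to the boundary leaves room for the radius and for the logarithm.
  set r : ℝ := (s.re + 1 / 2) / 3 with hr
  have hr0 : 0 < r := by rw [hr]; linarith
  have hmeas : ∀ z, AEStronglyMeasurable (fun t => kernel z t * H t) volume := fun z =>
    (continuous_kernel z).aestronglyMeasurable.mul hH
  have key := hasDerivAt_integral_of_dominated_loc_of_deriv_le (𝕜 := ℂ)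
    (F := fun z t => kernel z t * H t) (x₀ := s) (s := Metric.ball s r) (μ := volume)
    (F' := fun z t => (-(Real.log (1 + t ^ 2) : ℝ) * kernel z t) * H t)
    (bound := fun t => C / r * (1 + t ^ 2) ^ (-(1 / 2 + r)))
    (Metric.ball_mem_nhds s hr0) (Filter.Eventually.of_forall hmeas)
    (integrable_kernel_mul hH hC hs')
    (by
      have := continuous_kernel s
      have h2 : Continuous fun t : ℝ => ((Real.log (1 + t ^ 2) : ℝ) : ℂ) :=
        Complex.continuous_ofReal.comp continuous_log_one_add_sq
      exact (h2.neg.mul this).aestronglyMeasurable.mul hH)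
    (Filter.Eventually.of_forall fun t z hz => by
      have hz' : s.re - r ≤ z.re := by
        have h1 := (Complex.abs_re_le_norm (z - s)).trans (mem_ball_iff_norm.1 hz).le
        rw [Complex.sub_re] at h1
        linarith [(abs_le.1 h1).1]
      have h1 : (1 : ℝ) ≤ 1 + t ^ 2 := by nlinarith [sq_nonneg t]
      have hlog0 : 0 ≤ Real.log (1 + t ^ 2) := Real.log_nonneg h1
      have hlog : Real.log (1 + t ^ 2) ≤ (1 + t ^ 2) ^ r / r :=
        Real.log_le_rpow_div (one_add_sq_pos t).le hr0
      rw [norm_mul, norm_mul, norm_neg, Complex.norm_real, Real.norm_of_nonneg hlog0, norm_kernel]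
      calc Real.log (1 + t ^ 2) * (1 + t ^ 2) ^ (-(z.re + 1 / 2)) * ‖H t‖
          ≤ ((1 + t ^ 2) ^ r / r) * (1 + t ^ 2) ^ (-(s.re - r + 1 / 2))
            * (C * (1 + t ^ 2) ^ (-(1 / 2) : ℝ)) := by
            gcongr
            exact hC t
        _ = C / r * ((1 + t ^ 2) ^ r * (1 + t ^ 2) ^ (-(s.re - r + 1 / 2))
            * (1 + t ^ 2) ^ (-(1 / 2) : ℝ)) := by ring
        _ = C / r * (1 + t ^ 2) ^ (-(1 / 2 + r)) := by
            rw [← Real.rpow_add (one_add_sq_pos t), ← Real.rpow_add (one_add_sq_pos t)]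
            congr 2
            rw [hr]
            ring)
    ((integrable_one_add_sq_rpow (r := 1 / 2 + r) (by linarith)).const_mul _)
    (Filter.Eventually.of_forall fun t z _ => (hasDerivAt_kernel_param z t).mul_const (H t))
  exact key.2.differentiableAt.differentiableWithinAt

/-! ### Jacquet's integral as a Fourier integral -/

/-- The function `φ(·, s)` on the big cell, `t ↦ φ(w n[t], s)`. -/
def bigCell (c : U) (s : ℂ) (t : ℝ) : ℂ := kernel s t * lineSum c t

theorem height_angle_w_n_a {y : ℝ} (hy : 0 < y) (t : ℝ) :
    height (w * n (y * t) * a y) = y⁻¹ * height (w * n t) ∧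
      angle (w * n (y * t) * a y) = lineAngle t := by
  have h0 : √y ≠ 0 := (Real.sqrt_pos.2 hy).ne'
  have hy2 : y = √y * √y := (Real.mul_self_sqrt hy.le).symm
  have hb : bottom (weylMatrix * shearMatrix (y * t) * diagMatrix hy)
      = (√y : ℝ) * bottom (weylMatrix * shearMatrix t) := by
    have h0' : (√y : ℂ) ≠ 0 := by exact_mod_cast h0
    have hy2' : (y : ℂ) = √y * √y := by exact_mod_cast hy2
    rw [bottom_weyl_mul_shear, bottom, Matrix.SpecialLinearGroup.coe_mul, coe_weyl_mul_shear,
      coe_diagMatrix]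
    simp [Matrix.mul_apply, Fin.sum_univ_two]
    field_simp
    rw [hy2']
    ring
  rw [a_eq hy, w_mul_n_eq, ← mk_mul, height_of_bottom_eq hb, angle_of_bottom_eq hb, ← w_mul_n_eq,
    angle_w_mul_n, Real.sq_sqrt hy.le]
  exact ⟨rfl, rfl⟩

theorem smoothFun_w_n_a (c : U) (s : ℂ) {y : ℝ} (hy : 0 < y) (t : ℝ) :
    smoothFun c s (w * n (y * t) * a y) = ((y⁻¹ : ℝ) : ℂ) ^ (s + 1 / 2) * bigCell c s t := by
  rw [smoothFun_eq, (height_angle_w_n_a hy t).1, (height_angle_w_n_a hy t).2, Complex.ofReal_mul,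
    Complex.mul_cpow_ofReal_nonneg (by positivity) (height_pos _).le, height_cpow_eq_kernel,
    mul_assoc]
  rfl

theorem mul_inv_cpow {y : ℝ} (hy : 0 < y) (s : ℂ) :
    (y : ℂ) * ((y⁻¹ : ℝ) : ℂ) ^ (s + 1 / 2) = (y : ℂ) ^ (-s + 1 / 2) := by
  have hy' : (y : ℂ) ≠ 0 := by exact_mod_cast hy.ne'
  have h1 : (-s + 1 / 2 : ℂ) = 1 + -(s + 1 / 2) := by ring
  rw [h1, Complex.cpow_add _ _ hy', Complex.cpow_one, Complex.cpow_neg, Complex.ofReal_inv,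
    Complex.inv_cpow]
  rw [Complex.arg_ofReal_of_nonneg hy.le]
  exact Real.pi_ne_zero.symm

theorem inv_one_add_sq_le_decay (t : ℝ) : (1 + t ^ 2 : ℝ)⁻¹ ≤ (1 + t ^ 2) ^ (-(1 / 2) : ℝ) := by
  rw [← Real.rpow_neg_one]
  exact Real.rpow_le_rpow_of_exponent_le (by nlinarith [sq_nonneg t]) (by norm_num)

theorem abs_div_le_decay (t : ℝ) : |t / (1 + t ^ 2)| ≤ (1 + t ^ 2) ^ (-(1 / 2) : ℝ) := by
  have h0 := one_add_sq_pos t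
  rw [abs_div, abs_of_pos h0, div_le_iff₀ h0]
  nth_rewrite 2 [← Real.rpow_one (1 + t ^ 2)]
  rw [← Real.rpow_add h0]
  norm_num
  rw [← Real.sqrt_eq_rpow]
  exact Real.abs_le_sqrt (by linarith)

theorem norm_bigCell_le {c : U} (hc : IsSmooth c) (s : ℂ) (t : ℝ) :
    ‖bigCell c s t‖ ≤ (∑' p, ‖c p‖) * (1 + t ^ 2) ^ (-(s.re + 1 / 2)) := by
  have h0 := one_add_sq_pos t
  rw [bigCell, norm_mul, norm_kernel, mul_comm]
  gcongr
  exact norm_smoothSum_le hc _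

theorem continuous_bigCell {c : U} (hc : IsSmooth c) (s : ℂ) : Continuous (bigCell c s) :=
  (continuous_kernel s).mul (continuous_lineSum hc)

theorem integrable_bigCell {c : U} (hc : IsSmooth c) {s : ℂ} (hs : 0 < s.re) :
    Integrable (bigCell c s) :=
  ((integrable_one_add_sq_rpow (r := s.re + 1 / 2) (by linarith)).const_mul _).mono'
    (continuous_bigCell hc s).aestronglyMeasurable
    (Filter.Eventually.of_forall fun t => norm_bigCell_le hc s t)

theorem sign_mul_abs_mul (u t : ℝ) : Real.sign u * (|u| * t) = u * t := by
  rw [← mul_assoc]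
  congr 1
  rcases lt_trichotomy u 0 with h | h | h
  · rw [Real.sign_of_neg h, abs_of_neg h]; ring
  · rw [h]; simp
  · rw [Real.sign_of_pos h, abs_of_pos h]; ring

theorem norm_e (x : ℝ) : ‖e x‖ = 1 := by
  have : e x = Complex.exp ((2 * Real.pi * x : ℝ) * Complex.I) := by
    rw [e]; congr 1; push_cast; ring
  rw [this, Complex.norm_exp_ofReal_mul_I]

theorem continuous_e : Continuous e := by unfold e; fun_prop

open FourierTransform in
theorem fourier_eq_integral_e (f : ℝ → ℂ) (u : ℝ) : 𝓕 f u = ∫ t, e (-(u * t)) * f t := by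
  rw [Real.fourier_real_eq_integral_exp_smul]
  refine integral_congr_ae (Filter.Eventually.of_forall fun t => ?_)
  simp only [smul_eq_mul, e]
  congr 2
  push_cast
  ring

/-- The integrand of Jacquet's integral at `a[|u|]`, rescaled. -/
theorem jacquet_integrand {u : ℝ} (hu : u ≠ 0) (c : U) (s : ℂ) (ξ : ℝ) :
    e (-(Real.sign u * ξ)) * smoothFun c s (w * n ξ * a |u|)
      = ((|u|⁻¹ : ℝ) : ℂ) ^ (s + 1 / 2) * (e (-(u * (ξ / |u|))) * bigCell c s (ξ / |u|)) := by
  have hy : 0 < |u| := abs_pos.2 hu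
  obtain ⟨t, rfl⟩ : ∃ t, ξ = |u| * t := ⟨ξ / |u|, by field_simp⟩
  rw [smoothFun_w_n_a c s hy, sign_mul_abs_mul, mul_div_cancel_left₀ _ hy.ne']
  ring

theorem integrable_e_mul_bigCell {c : U} (hc : IsSmooth c) {s : ℂ} (hs : 0 < s.re) (u : ℝ) :
    Integrable fun t => e (-(u * t)) * bigCell c s t := by
  refine (integrable_bigCell hc hs).bdd_mul (c := 1) ?_ ?_
  · have := continuous_e
    fun_prop
  · exact Filter.Eventually.of_forall fun t => (norm_e _).le

theorem integrable_jacquet_integrand {u : ℝ} (hu : u ≠ 0) {c : U} (hc : IsSmooth c) {s : ℂ}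
    (hs : 0 < s.re) :
    Integrable fun ξ : ℝ => e (-(Real.sign u * ξ)) * smoothFun c s (w * n ξ * a |u|) := by
  simp_rw [jacquet_integrand hu]
  exact ((integrable_e_mul_bigCell hc hs u).comp_div (abs_pos.2 hu).ne').const_mul _

open FourierTransform in
/-- Jacquet's integral at `a[|u|]` is `|u|^{1/2 - s}` times the Fourier integral at `u` of the
restriction to the big cell. -/
theorem jacquetIntegral_eq_fourier {u : ℝ} (hu : u ≠ 0) (c : U) (s : ℂ) :
    jacquetIntegral (Real.sign u) (smoothFun c s) (a |u|)
      = ((|u| : ℝ) : ℂ) ^ (-s + 1 / 2) * 𝓕 (bigCell c s) u := by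
  rw [jacquetIntegral]
  simp_rw [jacquet_integrand hu]
  rw [integral_const_mul,
    Measure.integral_comp_div (fun t => e (-(u * t)) * bigCell c s t) |u|, fourier_eq_integral_e,
    abs_abs, Complex.real_smul, ← mul_inv_cpow (abs_pos.2 hu)]
  ring

/-! ### The analytic continuation -/

theorem hasDerivAt_bigCell {c : U} (hc : IsSmooth c) (s : ℂ) (t : ℝ) :
    HasDerivAt (bigCell c s) (-(2 * s + 1) * (kernel s t * ((t / (1 + t ^ 2) : ℝ) * lineSum c t))
      + kernel s t * (((1 + t ^ 2 : ℝ)⁻¹ : ℝ) * lineSumDeriv c t)) t := by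
  refine ((hasDerivAt_kernel s t).mul (hasDerivAt_lineSum hc t)).congr_deriv ?_
  rw [one_div]
  ring

section Continuation

variable {c : U} (hc : IsSmooth c) (u : ℝ)
include hc

theorem continuous_continuation_integrands :
    Continuous (fun t : ℝ => e (-(u * t)) * ((t / (1 + t ^ 2) : ℝ) * lineSum c t)) ∧
    Continuous (fun t : ℝ => e (-(u * t)) * (((1 + t ^ 2 : ℝ)⁻¹ : ℝ) * lineSumDeriv c t)) := by
  have h1 := continuous_e
  have h2 := continuous_lineSum hc
  have h3 := continuous_lineSumDeriv hc
  have h4 : Continuous fun t : ℝ => t / (1 + t ^ 2) :=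
    continuous_id.div (by fun_prop) fun t => (one_add_sq_pos t).ne'
  have h5 : Continuous fun t : ℝ => (1 + t ^ 2)⁻¹ :=
    Continuous.inv₀ (by fun_prop) fun t => (one_add_sq_pos t).ne'
  constructor <;> fun_prop

theorem norm_continuation_integrands_le (t : ℝ) :
    ‖e (-(u * t)) * ((t / (1 + t ^ 2) : ℝ) * lineSum c t)‖
      ≤ (∑' p, ‖c p‖) * (1 + t ^ 2) ^ (-(1 / 2) : ℝ) ∧
    ‖e (-(u * t)) * (((1 + t ^ 2 : ℝ)⁻¹ : ℝ) * lineSumDeriv c t)‖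
      ≤ (∑' p : ℤ, 2 * (|(p : ℝ)| * ‖c p‖)) * (1 + t ^ 2) ^ (-(1 / 2) : ℝ) := by
  have h0 := one_add_sq_pos t
  constructor
  · rw [norm_mul, norm_mul, norm_e, one_mul, Complex.norm_real, mul_comm]
    exact mul_le_mul (norm_smoothSum_le hc _) (abs_div_le_decay t) (norm_nonneg _)
      (tsum_nonneg fun p => norm_nonneg _)
  · rw [norm_mul, norm_mul, norm_e, one_mul, Complex.norm_real,
      Real.norm_of_nonneg (by positivity), mul_comm]
    exact mul_le_mul (norm_lineSumDeriv_le hc _) (inv_one_add_sq_le_decay t) (by positivity)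
      (tsum_nonneg fun p => by positivity)

omit hc in
/-- The continuation of Jacquet's integral, found by one integration by parts. -/
def jacquetContinuation (c : U) (u : ℝ) (s : ℂ) : ℂ :=
  ((|u| : ℝ) : ℂ) ^ (-s + 1 / 2) * ((2 * Real.pi * Complex.I * u)⁻¹ *
    (-(2 * s + 1) * (∫ t, kernel s t * (e (-(u * t)) * ((t / (1 + t ^ 2) : ℝ) * lineSum c t)))
      + ∫ t, kernel s t * (e (-(u * t)) * (((1 + t ^ 2 : ℝ)⁻¹ : ℝ) * lineSumDeriv c t))))

theorem isJacquetContinuation {u : ℝ} (hu : u ≠ 0) :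
    IsJacquetContinuation (Real.sign u) c (a |u|) (jacquetContinuation c u) := by
  obtain ⟨hm1, hm2⟩ := continuous_continuation_integrands hc u
  have hb1 := fun t => (norm_continuation_integrands_le hc u t).1
  have hb2 := fun t => (norm_continuation_integrands_le hc u t).2
  constructor
  · have hd1 := differentiableOn_integral_kernel hm1.aestronglyMeasurable hb1
    have hd2 := differentiableOn_integral_kernel hm2.aestronglyMeasurable hb2
    have hd3 : Differentiable ℂ fun s : ℂ => ((|u| : ℝ) : ℂ) ^ (-s + 1 / 2) := by
      have h0 : ((|u| : ℝ) : ℂ) ≠ 0 := by exact_mod_cast (abs_pos.2 hu).ne'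
      exact ((differentiable_id.neg).add_const _).const_cpow (Or.inl h0)
    have hd4 : Differentiable ℂ fun s : ℂ => -(2 * s + 1) := by fun_prop
    exact hd3.differentiableOn.mul (((hd4.differentiableOn.mul hd1).add hd2).const_mul _)
  · intro s hs
    refine ⟨integrable_jacquet_integrand hu hc hs, ?_⟩
    have hs' : -(1 / 2 : ℝ) < s.re := by linarith
    rw [jacquetIntegral_eq_fourier hu, jacquetContinuation]
    congr 1
    have hderiv : deriv (bigCell c s) = fun t =>
        -(2 * s + 1) * (kernel s t * ((t / (1 + t ^ 2) : ℝ) * lineSum c t))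
          + kernel s t * (((1 + t ^ 2 : ℝ)⁻¹ : ℝ) * lineSumDeriv c t) :=
      funext fun t => (hasDerivAt_bigCell hc s t).deriv
    -- Both terms of the derivative are integrable: take `u = 0` in the estimates above.
    have hint : Integrable (deriv (bigCell c s)) := by
      have he : ∀ t : ℝ, e (-((0 : ℝ) * t)) = 1 := fun t => by simp [e]
      have i1 := integrable_kernel_mul
        (continuous_continuation_integrands hc 0).1.aestronglyMeasurable
        (fun t => (norm_continuation_integrands_le hc 0 t).1) hs'
      have i2 := integrable_kernel_mul
        (continuous_continuation_integrands hc 0).2.aestronglyMeasurable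
        (fun t => (norm_continuation_integrands_le hc 0 t).2) hs'
      simp only [he, one_mul] at i1 i2
      rw [hderiv]
      exact (i1.const_mul _).add i2
    have hF := congrFun (Real.fourier_deriv (integrable_bigCell hc hs)
      (fun t => (hasDerivAt_bigCell hc s t).differentiableAt) hint) u
    have hu' : (2 * Real.pi * Complex.I * u : ℂ) ≠ 0 := by
      simp [Real.pi_ne_zero, hu]
    rw [smul_eq_mul, fourier_eq_integral_e, hderiv] at hF
    rw [eq_comm, ← mul_right_inj' hu', ← hF, mul_inv_cancel_left₀ hu', ← integral_const_mul,
      ← integral_add ((integrable_kernel_mul hm1.aestronglyMeasurable hb1 hs').const_mul _)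
        (integrable_kernel_mul hm2.aestronglyMeasurable hb2 hs')]
    refine integral_congr_ae (Filter.Eventually.of_forall fun t => ?_)
    ring

end Continuation

/-! ### The Kirillov operator -/

theorem memLp_bigCell {c : U} (hc : IsSmooth c) {s : ℂ} (hs : 0 ≤ s.re) :
    MemLp (bigCell c s) 2 := by
  rw [memLp_two_iff_integrable_sq_norm (continuous_bigCell hc s).aestronglyMeasurable]
  refine ((integrable_one_add_sq_rpow (r := 2 * s.re + 1) (by linarith)).const_mul
    ((∑' p, ‖c p‖) ^ 2)).mono' ((continuous_bigCell hc s).norm.pow 2).aestronglyMeasurable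
    (Filter.Eventually.of_forall fun t => ?_)
  rw [norm_pow, norm_norm]
  calc ‖bigCell c s t‖ ^ 2
      ≤ ((∑' p, ‖c p‖) * (1 + t ^ 2) ^ (-(s.re + 1 / 2))) ^ 2 := by
        gcongr
        exact norm_bigCell_le hc s t
    _ = (∑' p, ‖c p‖) ^ 2 * (1 + t ^ 2) ^ (-(2 * s.re + 1)) := by
        rw [mul_pow, ← Real.rpow_natCast ((1 + t ^ 2) ^ _), ← Real.rpow_mul (one_add_sq_pos t).le]
        congr 2
        push_cast
        ring

/-- The restriction to the big cell depends continuously on `s` in `L²(ℝ)`, up to the imaginary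
axis. -/
theorem tendsto_toLp_bigCell {c : U} (hc : IsSmooth c) {s : ℕ → ℂ} (hs : ∀ m, 0 ≤ (s m).re)
    {ν : ℂ} (hν : 0 ≤ ν.re) (hlim : Filter.Tendsto s Filter.atTop (nhds ν)) :
    Filter.Tendsto (fun m => (memLp_bigCell hc (hs m)).toLp (bigCell c (s m))) Filter.atTop
      (nhds ((memLp_bigCell hc hν).toLp (bigCell c ν))) := by
  rw [Lp.tendsto_Lp_iff_tendsto_eLpNorm'' (fun m => bigCell c (s m))
    (fun m => memLp_bigCell hc (hs m))]
  simp_rw [eLpNorm_two_eq]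
  have hM0 : 0 ≤ ∑' p, ‖c p‖ := tsum_nonneg fun p => norm_nonneg _
  set M := ∑' p, ‖c p‖ with hM
  have hle : ∀ z : ℂ, 0 ≤ z.re → ∀ t, ‖bigCell c z t‖ ≤ M * (1 + t ^ 2) ^ (-(1 / 2) : ℝ) := by
    intro z hz t
    refine (norm_bigCell_le hc z t).trans ?_
    refine mul_le_mul_of_nonneg_left ?_ hM0
    exact Real.rpow_le_rpow_of_exponent_le (by nlinarith [sq_nonneg t]) (by linarith)
  have h1 : Filter.Tendsto (fun m => ∫⁻ t, ‖(bigCell c (s m) - bigCell c ν) t‖ₑ ^ 2)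
      Filter.atTop (nhds (∫⁻ _ : ℝ, 0)) := by
    refine tendsto_lintegral_of_dominated_convergence'
      (fun t => ENNReal.ofReal ((2 * M) ^ 2 * (1 + t ^ 2) ^ (-1 : ℝ)))
      (fun m => ?_) (fun m => ?_) ?_ ?_
    · exact (((continuous_bigCell hc (s m)).sub
        (continuous_bigCell hc ν)).aestronglyMeasurable.enorm.pow_const 2)
    · refine Filter.Eventually.of_forall fun t => ?_
      beta_reduce
      rw [← ofReal_norm, ← ENNReal.ofReal_pow (norm_nonneg _)]
      refine ENNReal.ofReal_le_ofReal ?_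
      calc ‖(bigCell c (s m) - bigCell c ν) t‖ ^ 2
          ≤ (2 * M * (1 + t ^ 2) ^ (-(1 / 2) : ℝ)) ^ 2 := by
            gcongr
            refine (norm_sub_le _ _).trans ?_
            linarith [hle (s m) (hs m) t, hle ν hν t]
        _ = (2 * M) ^ 2 * (1 + t ^ 2) ^ (-1 : ℝ) := by
            rw [mul_pow, ← Real.rpow_natCast ((1 + t ^ 2) ^ _),
              ← Real.rpow_mul (one_add_sq_pos t).le]
            norm_num
    · have := ((integrable_one_add_sq_rpow (r := 1) (by norm_num)).const_mul ((2 * M) ^ 2))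
      exact (this.lintegral_lt_top).ne
    · refine Filter.Eventually.of_forall fun t => ?_
      have hk : Filter.Tendsto (fun m => bigCell c (s m) t - bigCell c ν t) Filter.atTop
          (nhds 0) := by
        have := (((hasDerivAt_kernel_param ν t).continuousAt.tendsto.comp hlim).mul_const
          (lineSum c t)).sub_const (bigCell c ν t)
        simpa [bigCell] using this
      have := (ENNReal.continuous_pow 2).tendsto 0 |>.comp
        ((continuous_enorm.tendsto (0 : ℂ)).comp hk |>.trans (by simp))
      simpa [Function.comp_def] using this
  rw [lintegral_zero] at h1
  have h2 := ((ENNReal.continuous_rpow_const (y := (1 / 2 : ℝ))).tendsto 0).comp h1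
  rw [ENNReal.zero_rpow_of_pos (by norm_num)] at h2
  exact h2

/-- The Kirillov operator as a unitary map: pass to the big cell, apply the Fourier transform, and
multiply by `|u|^{1/2 - ν}`. -/
def kirillovEquiv {ν : ℂ} (hν : ν.re = 0) : U ≃ₗᵢ[ℂ] L2 :=
  circleFun.trans (((isWeight_line hν).equiv measurable_lineCoord lineCoord_lineAngle).trans
    ((Lp.fourierTransformₗᵢ ℝ ℂ).trans
      ((isWeight_kirillov hν).equiv measurable_id (fun _ => rfl))))

theorem line_circleFun {ν : ℂ} (hν : ν.re = 0) {c : U} (hc : IsSmooth c) :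
    (isWeight_line hν).equiv measurable_lineCoord lineCoord_lineAngle (circleFun c)
      = (((√Real.pi)⁻¹ : ℝ) : ℂ) • (memLp_bigCell hc hν.ge).toLp (bigCell c ν) := by
  apply Lp.ext
  filter_upwards [(isWeight_line hν).coeFn_equiv measurable_lineCoord lineCoord_lineAngle
    (circleFun c), Lp.coeFn_smul (((√Real.pi)⁻¹ : ℝ) : ℂ)
      ((memLp_bigCell hc hν.ge).toLp (bigCell c ν)), (memLp_bigCell hc hν.ge).coeFn_toLp,
    (isWeight_line hν).quasiMeasurePreserving.ae (coeFn_circleFun_eq_smoothSum hc)]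
    with t h1 h2 h3 h4
  rw [h1, h2, Pi.smul_apply, h3, h4, smul_eq_mul, lineWeight, height_cpow_eq_kernel, mul_assoc]
  rfl

theorem coeFn_kirillovEquiv {ν : ℂ} (hν : ν.re = 0) {c : U} (hc : IsSmooth c) :
    (kirillovEquiv hν c : ℝ → ℂ) =ᵐ[mulMeasure] fun u => ((|u| : ℝ) : ℂ) ^ (-ν + 1 / 2) *
      (Lp.fourierTransformₗᵢ ℝ ℂ ((memLp_bigCell hc hν.ge).toLp (bigCell c ν)) : ℝ → ℂ) u := by
  have h0 : kirillovEquiv hν c = (isWeight_kirillov hν).equiv measurable_id (fun _ => rfl)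
      ((((√Real.pi)⁻¹ : ℝ) : ℂ) • Lp.fourierTransformₗᵢ ℝ ℂ
        ((memLp_bigCell hc hν.ge).toLp (bigCell c ν))) := by
    rw [← map_smul, ← line_circleFun hν hc]
    rfl
  rw [h0]
  filter_upwards [(isWeight_kirillov hν).coeFn_equiv measurable_id (fun _ => rfl)
      ((((√Real.pi)⁻¹ : ℝ) : ℂ) • Lp.fourierTransformₗᵢ ℝ ℂ
        ((memLp_bigCell hc hν.ge).toLp (bigCell c ν))),
    mulMeasure_absolutelyContinuous.ae_le (Lp.coeFn_smul (((√Real.pi)⁻¹ : ℝ) : ℂ)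
      (Lp.fourierTransformₗᵢ ℝ ℂ ((memLp_bigCell hc hν.ge).toLp (bigCell c ν))))] with u h1 h2
  have hpi : ((√Real.pi : ℝ) : ℂ) ≠ 0 := by
    exact_mod_cast (Real.sqrt_pos.2 Real.pi_pos).ne'
  rw [h1, id, h2, Pi.smul_apply, smul_eq_mul, kirillovWeight, Complex.ofReal_inv]
  field_simp

open FourierTransform in
/-- The pointwise values of the continuation are limits of Fourier integrals. -/
theorem tendsto_fourier_bigCell {c : U} (hc : IsSmooth c) {u : ℝ} (hu : u ≠ 0) {s : ℕ → ℂ}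
    (hs : ∀ m, 0 < (s m).re) {ν : ℂ} (hν : ν.re = 0)
    (hlim : Filter.Tendsto s Filter.atTop (nhds ν)) :
    Filter.Tendsto (fun m => ((|u| : ℝ) : ℂ) ^ (-(s m) + 1 / 2) * 𝓕 (bigCell c (s m)) u)
      Filter.atTop (nhds (kirillov ν c u)) := by
  have hex : ∃ F : ℂ → ℂ, IsJacquetContinuation (Real.sign u) c (a |u|) F :=
    ⟨_, isJacquetContinuation hc hu⟩
  have hk : kirillov ν c u = hex.choose ν := by rw [kirillov, jacquet, dif_pos hex]
  obtain ⟨hd, hF⟩ := hex.choose_spec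
  have hopen : IsOpen {s : ℂ | -(1 / 2 : ℝ) < s.re} :=
    isOpen_lt continuous_const Complex.continuous_re
  have hmem : ν ∈ {s : ℂ | -(1 / 2 : ℝ) < s.re} := by
    change -(1 / 2 : ℝ) < ν.re
    rw [hν]
    norm_num
  have hct := (hd.continuousOn.continuousAt (hopen.mem_nhds hmem)).tendsto.comp hlim
  rw [hk]
  refine hct.congr fun m => ?_
  rw [Function.comp, (hF (s m) (hs m)).2, jacquetIntegral_eq_fourier hu]

theorem kirillovEquiv_extends {ν : ℂ} (hν : ν.re = 0) :
    ExtendsKirillov ν (kirillovEquiv hν : U →L[ℂ] L2) := by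
  intro c hc
  -- Approach the imaginary axis from the half-plane of absolute convergence.
  set s : ℕ → ℂ := fun m => ν + ((1 / ((m : ℝ) + 1) : ℝ) : ℂ) with hs
  have hsre : ∀ m, 0 < (s m).re := by
    intro m
    rw [hs]
    simp only [Complex.add_re, Complex.ofReal_re, hν, zero_add]
    positivity
  have hlim : Filter.Tendsto s Filter.atTop (nhds ν) := by
    have h := (Complex.continuous_ofReal.tendsto 0).comp
      (tendsto_one_div_add_atTop_nhds_zero_nat (𝕜 := ℝ))
    simpa [hs, Function.comp_def] using h.const_add ν
  have hL := ((Lp.fourierTransformₗᵢ ℝ ℂ).continuous.tendsto _).comp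
    (tendsto_toLp_bigCell hc (fun m => (hsre m).le) hν.ge hlim)
  obtain ⟨ns, hns, hae⟩ := (tendstoInMeasure_of_tendsto_Lp hL).exists_seq_tendsto_ae
  have hfour : ∀ᵐ u : ℝ, ∀ m, (Lp.fourierTransformₗᵢ ℝ ℂ
      ((memLp_bigCell hc (hsre m).le).toLp (bigCell c (s m))) : ℝ → ℂ) u
        = FourierTransform.fourier (bigCell c (s m)) u :=
    ae_all_iff.2 fun m => coeFn_fourierTransform_toLp (integrable_bigCell hc (hsre m)) _
  filter_upwards [coeFn_kirillovEquiv hν hc, mulMeasure_absolutelyContinuous.ae_le hae,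
    mulMeasure_absolutelyContinuous.ae_le hfour, ae_ne_zero_mulMeasure] with u h1 h2 h3 hu
  have h4 := (tendsto_fourier_bigCell hc hu hsre hν hlim).comp hns.tendsto_atTop
  have h5 : Filter.Tendsto (fun m => ((|u| : ℝ) : ℂ) ^ (-(s m) + 1 / 2)) Filter.atTop
      (nhds (((|u| : ℝ) : ℂ) ^ (-ν + 1 / 2))) := by
    have h0 : ((|u| : ℝ) : ℂ) ≠ 0 := by exact_mod_cast (abs_pos.2 hu).ne'
    exact (hlim.neg.add_const _).const_cpow (Or.inl h0)
  have h6 := (h5.comp hns.tendsto_atTop).mul h2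
  refine (h1.trans (tendsto_nhds_unique h6 (h4.congr fun m => ?_)))
  simp only [Function.comp, h3]

/-! ### Uniqueness of the extension -/

theorem isSmooth_single (p : ℤ) (z : ℂ) : IsSmooth (lp.single 2 p z : U) := by
  intro N
  refine ⟨|(p : ℝ)| ^ N * ‖z‖, fun q => ?_⟩
  by_cases h : q = p
  · subst h
    simp
  · have h0 : (lp.single 2 p z : U) q = 0 :=
      lp.single_apply_ne (E := fun _ : ℤ => ℂ) 2 p z h
    rw [h0, norm_zero, mul_zero]
    positivity

/-- A bounded operator is determined by its values on smooth vectors, as these contain every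
`φ_p`. -/
theorem eq_of_eqOn_smooth {T S : U →L[ℂ] L2} (h : ∀ c, IsSmooth c → T c = S c) : T = S := by
  ext1 c
  have hc := lp.hasSum_single (p := 2) (by norm_num) c
  refine HasSum.unique (hc.mapL T) ?_
  convert hc.mapL S using 2 with p
  exact h _ (isSmooth_single p (c p))

theorem extendsKirillov_iff {ν : ℂ} (hν : ν.re = 0) (T : U →L[ℂ] L2) :
    ExtendsKirillov ν T ↔ T = (kirillovEquiv hν : U →L[ℂ] L2) := by
  constructor
  · intro hT
    exact eq_of_eqOn_smooth fun c hc =>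
      Lp.ext ((hT c hc).trans (kirillovEquiv_extends hν c hc).symm)
  · rintro rfl
    exact kirillovEquiv_extends hν

/-! ### Transport of representations -/

/-- The representation `S ω S⁻¹`. -/
def conjRep {H₁ H₂ : Type*} [NormedAddCommGroup H₁] [InnerProductSpace ℂ H₁]
    [NormedAddCommGroup H₂] [InnerProductSpace ℂ H₂] (S : H₁ ≃ₗᵢ[ℂ] H₂)
    (ω : G →* (H₁ ≃ₗᵢ[ℂ] H₁)) : G →* (H₂ ≃ₗᵢ[ℂ] H₂) where
  toFun h := S.symm.trans ((ω h).trans S)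
  map_one' := by
    ext v
    simp
  map_mul' g h := by
    ext v
    simp

theorem IsUnitaryRep.conjRep {H₁ H₂ : Type*} [NormedAddCommGroup H₁] [InnerProductSpace ℂ H₁]
    [NormedAddCommGroup H₂] [InnerProductSpace ℂ H₂] (S : H₁ ≃ₗᵢ[ℂ] H₂)
    {ω : G →* (H₁ ≃ₗᵢ[ℂ] H₁)} (hω : IsUnitaryRep ω) : IsUnitaryRep (conjRep S ω) :=
  fun v => S.continuous.comp (hω (S.symm v))

end Kirillov

end

theorem lemma6p2 (ν : ℂ) (hν : ν.re = 0) :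
    -- Jacquet's integral and its continuation make sense on every smooth vector
    (∀ c : Kirillov.U, Kirillov.IsSmooth c → ∀ u : ℝ, u ≠ 0 →
      ∃ F : ℂ → ℂ, Kirillov.IsJacquetContinuation (Real.sign u) c (Kirillov.a |u|) F) ∧
    ∃ K : Kirillov.U ≃ₗᵢ[ℂ] Kirillov.L2,
      -- `K` is the Kirillov operator, i.e. the only bounded operator on `U_ν` that is given by
      -- `φ ↦ A^{sgn u} φ(a[|u|])` on smooth vectors
      (∀ T : Kirillov.U →L[ℂ] Kirillov.L2,
        Kirillov.ExtendsKirillov ν T ↔ T = (K : Kirillov.U →L[ℂ] Kirillov.L2)) ∧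
      ∃ (ω : Kirillov.G →* (Kirillov.U ≃ₗᵢ[ℂ] Kirillov.U))
        (ρ : Kirillov.G →* (Kirillov.L2 ≃ₗᵢ[ℂ] Kirillov.L2)),
        -- `ω` is right translation in `U_ν`
        (∀ (h : Kirillov.G) (c c' : Kirillov.U),
          Kirillov.IsRightTranslate ν h c c' ↔ c' = ω h c) ∧
        -- `ρ = K ω K⁻¹`
        (∀ h : Kirillov.G, ρ h = K.symm.trans ((ω h).trans K)) ∧
        Kirillov.IsUnitaryRep ω ∧ Kirillov.IsUnitaryRep ρ ∧
        Kirillov.UnitarilyEquivalent ω ρ := by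
  refine ⟨fun c hc u hu => ⟨_, Kirillov.isJacquetContinuation hc hu⟩,
    Kirillov.kirillovEquiv hν, Kirillov.extendsKirillov_iff hν, Kirillov.translate hν,
    Kirillov.conjRep (Kirillov.kirillovEquiv hν) (Kirillov.translate hν),
    Kirillov.isRightTranslate_iff hν, fun h => rfl, Kirillov.isUnitaryRep_translate hν,
    (Kirillov.isUnitaryRep_translate hν).conjRep _, Kirillov.kirillovEquiv hν, fun g v => ?_⟩
  change _ = Kirillov.kirillovEquiv hν (Kirillov.translate hν g
    ((Kirillov.kirillovEquiv hν).symm (Kirillov.kirillovEquiv hν v)))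
  rw [LinearIsometryEquiv.symm_apply_apply]
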